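/- Let $L$ be a compact smooth $7$-manifold (Hausdorff, without boundary). A $G_2$-structure on $L$ is a smooth $3$-form $\varphi$ such that for each $p\in L$ there is a linear isomorphism $T_pL\cong\mathbb{R}^7$ identifying $\varphi_p$ with $$\varphi_0=dx_{123}+dx_{145}+dx_{167}+dx_{246}-dx_{257}-dx_{347}-dx_{356},\qquad dx_{ijk}=dx_i\wedge dx_j\wedge dx_k.$$ Let $\varphi$ be an exact $G_2$-structure on $L$, i.e. $\varphi=d\beta$ for some smooth $2$-form $\beta$ on $L$. Then $(L,\varphi)$ admits no non-trivial infinitesimal symmetry: for every smooth vector field $X$ on $L$, $$\mathcal{L}_X\varphi=0\quad\text{if and only if}\quad X\equiv 0,$$ where $\mathcal{L}_X$ denotes the Lie derivative. -/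

import Mathlib

open scoped Manifold ContDiff

/-! ### Differential forms on smooth manifolds without boundary -/

section Forms

/-- The coordinate space `ℝⁿ`. -/
abbrev RSpace (n : ℕ) : Type := EuclideanSpace ℝ (Fin n)

/-- A (not necessarily smooth) differential `k`-form on an `n`-manifold `M`: an alternating
`k`-linear form on each tangent space. -/
abbrev DiffForm (n k : ℕ) (M : Type*) [TopologicalSpace M] [ChartedSpace (RSpace n) M] : Type _ :=
  (x : M) → (TangentSpace (𝓡 n) x) [⋀^Fin k]→L[ℝ] ℝ

variable {n k : ℕ} {M : Type*} [TopologicalSpace M] [ChartedSpace (RSpace n) M]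

/-- The expression of `α` in the preferred chart around `x₀`: the pullback of `α` under the inverse
of that chart, a form on `ℝⁿ` (meaningful on the target of the chart). -/
noncomputable def DiffForm.inChart (α : DiffForm n k M) (x₀ : M) :
    RSpace n → (RSpace n) [⋀^Fin k]→L[ℝ] ℝ := fun y ↦
  (α ((extChartAt (𝓡 n) x₀).symm y)).compContinuousLinearMap
    (mfderiv 𝓘(ℝ, RSpace n) (𝓡 n) (extChartAt (𝓡 n) x₀).symm y)

/-- A form on `ℝⁿ`, evaluated at the image of `x` under the preferred chart around `x`, pulled back
to the tangent space at `x` by that chart. -/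
noncomputable def chartPullbackAt (x : M) (η : (RSpace n) [⋀^Fin k]→L[ℝ] ℝ) :
    (TangentSpace (𝓡 n) x) [⋀^Fin k]→L[ℝ] ℝ :=
  η.compContinuousLinearMap (mfderiv (𝓡 n) 𝓘(ℝ, RSpace n) (extChartAt (𝓡 n) x) x)

/-- A form is smooth if its expression in charts is `C^∞`. -/
def DiffForm.IsSmooth (α : DiffForm n k M) : Prop :=
  ∀ x₀ : M, ContDiffOn ℝ ∞ (α.inChart x₀) (extChartAt (𝓡 n) x₀).target

/-- The exterior derivative of a form on a manifold, computed in charts by Mathlib's exterior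
derivative on normed spaces. -/
noncomputable def DiffForm.d (α : DiffForm n k M) : DiffForm n (k + 1) M := fun x ↦
  chartPullbackAt x (extDeriv (α.inChart x) (extChartAt (𝓡 n) x x))

/-- A smooth vector field: a smooth section of the tangent bundle. -/
def IsSmoothVectorField [IsManifold (𝓡 n) ∞ M] (X : (x : M) → TangentSpace (𝓡 n) x) : Prop :=
  ContMDiff (𝓡 n) (𝓡 n).tangent ∞ (fun x ↦ (⟨x, X x⟩ : TangentBundle (𝓡 n) M))

/-- The Lie derivative of a form `η` along a vector field `V` on `ℝⁿ`, in coordinates; see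
`lieDerivCoord_apply` for the explicit formula. -/
noncomputable def lieDerivCoord (V : RSpace n → RSpace n)
    (η : RSpace n → (RSpace n) [⋀^Fin k]→L[ℝ] ℝ) (y : RSpace n) :
    (RSpace n) [⋀^Fin k]→L[ℝ] ℝ :=
  fderiv ℝ η y (V y) +
    (η y).fderivCompContinuousLinearMap (.id ℝ (RSpace n)) (fderiv ℝ V y)

/-- `(L_V η)(v₁, …, v_k) = (D_V η)(v₁, …, v_k) + ∑ i, η(v₁, …, D_{v_i} V, …, v_k)`. -/
theorem lieDerivCoord_apply (V : RSpace n → RSpace n)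
    (η : RSpace n → (RSpace n) [⋀^Fin k]→L[ℝ] ℝ) (y : RSpace n) (v : Fin k → RSpace n) :
    lieDerivCoord V η y v =
      fderiv ℝ η y (V y) v + ∑ i, η y (Function.update v i (fderiv ℝ V y (v i))) := by
  rw [lieDerivCoord, ContinuousAlternatingMap.add_apply,
    ContinuousAlternatingMap.fderivCompContinuousLinearMap_apply]
  congr 1
  refine Finset.sum_congr rfl fun i _ ↦ congrArg (η y) (funext fun j ↦ ?_)
  by_cases h : j = i
  · subst h; simp
  · simp [Function.update_of_ne h]

/-- The Lie derivative `L_X α` of a form along a vector field on a manifold, computed in charts.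
The vector field is transported to the chart by Mathlib's pullback of vector fields, as in
Mathlib's definition of the Lie bracket. -/
noncomputable def DiffForm.lieDeriv (X : (x : M) → TangentSpace (𝓡 n) x) (α : DiffForm n k M) :
    DiffForm n k M := fun x ↦
  chartPullbackAt x (lieDerivCoord
    (VectorField.mpullback 𝓘(ℝ, RSpace n) (𝓡 n) (extChartAt (𝓡 n) x).symm X) (α.inChart x)
    (extChartAt (𝓡 n) x x))

end Forms

/-! ### `G₂`-structures -/

section G2

/-- The determinant of three vectors of `ℝ³` as a continuous alternating form. -/
noncomputable def detForm3 : (Fin 3 → ℝ) [⋀^Fin 3]→L[ℝ] ℝ :=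
  { (Matrix.detRowAlternating : (Fin 3 → ℝ) [⋀^Fin 3]→ₗ[ℝ] ℝ) with
    cont := Continuous.matrix_det continuous_id }

/-- The 3-form `dx_{ijk} = dx_i ∧ dx_j ∧ dx_k` on `ℝ⁷`, with indices `1, …, 7`:
`dx_{ijk}(v₁, v₂, v₃)` is the determinant of the `i`-th, `j`-th, `k`-th coordinates of the
three vectors. -/
noncomputable def dxForm (i j k : Fin 7) : (RSpace 7) [⋀^Fin 3]→L[ℝ] ℝ :=
  detForm3.compContinuousLinearMap
    (ContinuousLinearMap.pi fun a ↦ EuclideanSpace.proj (𝕜 := ℝ) (![i, j, k] a))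

/-- The standard 3-form `φ₀ = dx₁₂₃ + dx₁₄₅ + dx₁₆₇ + dx₂₄₆ - dx₂₅₇ - dx₃₄₇ - dx₃₅₆` on `ℝ⁷`;
the coordinates `x₁, …, x₇` have indices `0, …, 6` here. -/
noncomputable def phi0 : (RSpace 7) [⋀^Fin 3]→L[ℝ] ℝ :=
  dxForm 0 1 2 + dxForm 0 3 4 + dxForm 0 5 6 + dxForm 1 3 5 - dxForm 1 4 6 - dxForm 2 3 6 - dxForm 2 4 5

/-- A `G₂`-structure on a 7-manifold: a smooth 3-form which at each point is identified with the
standard form `φ₀` by some linear isomorphism of the tangent space with `ℝ⁷`. -/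
def IsG2Structure {M : Type*} [TopologicalSpace M] [ChartedSpace (RSpace 7) M]
    (φ : DiffForm 7 3 M) : Prop :=
  φ.IsSmooth ∧ ∀ p : M, ∃ u : TangentSpace (𝓡 7) p ≃L[ℝ] RSpace 7,
    φ p = phi0.compContinuousLinearMap (u : TangentSpace (𝓡 7) p →L[ℝ] RSpace 7)

end G2

/-! If `L_X φ = 0`, then `a = i_X φ` is closed by Cartan's formula, since `φ = dβ` is closed. Hence
`φ ∧ a ∧ a = d(β ∧ a ∧ a)` is exact and has integral zero over the compact manifold. Pointwise,
however, `φ ∧ i_u φ ∧ i_u φ = 6 |u|² vol` for the metric and orientation that a G₂-form determines,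
so the integrand is nonnegative and `X` must vanish.

Wedge products into degree 7 are represented by `altCoeff`, the signed sum over all permutations of
the standard basis. It equals `3!·2!·2!` times the coefficient of a `3,2,2` wedge and `2!·2!·2!`
times that of a `1,2,2,2` wedge; the ratio 3 of these constants recurs below. Definiteness is
`altCoeff_tensor322_phi0_curryLeft`, carried to other G₂-forms by `altCoeff_tensor322_of_phi0_comp`.

No orientation is assumed. The form `φ` provides one: `orientSign` is locally constant in a chart
and picks up the sign of the Jacobian under a chart change, so multiplying by it turns a 7-form into
a density.

Stokes' theorem is proved with a partition of unity `ρ_i`. In one chart `d(ρ_i β ∧ a ∧ a)`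
integrates to zero (`integral_chartDensity_add`), and the terms `dρ_i ∧ β ∧ a ∧ a` cancel in the sum
because `∑ dρ_i = 0` (`sum_integral_chartDensity_eq_zero`). -/

/-! ### Forms of degree 7 on `ℝ⁷` as alternating sums -/

section AlternatingSums

/-- The tensor product of two multilinear forms. -/
noncomputable def formTensor {E : Type*} [AddCommGroup E] [Module ℝ E] {m n : ℕ}
    (f : MultilinearMap ℝ (fun _ : Fin m ↦ E) ℝ) (g : MultilinearMap ℝ (fun _ : Fin n ↦ E) ℝ) :
    MultilinearMap ℝ (fun _ : Fin (m + n) ↦ E) ℝ :=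
  ((LinearMap.mul' ℝ ℝ).compMultilinearMap (f.domCoprod g)).domDomCongr finSumFinEquiv

theorem formTensor_apply {E : Type*} [AddCommGroup E] [Module ℝ E] {m n : ℕ}
    (f : MultilinearMap ℝ (fun _ : Fin m ↦ E) ℝ) (g : MultilinearMap ℝ (fun _ : Fin n ↦ E) ℝ)
    (v : Fin (m + n) → E) :
    formTensor f g v = f (fun i ↦ v (Fin.castAdd n i)) * g (fun i ↦ v (Fin.natAdd m i)) := by
  simp [formTensor, MultilinearMap.domCoprod_apply]

/-- The standard basis of `ℝ⁷`. -/
noncomputable abbrev stdVec (i : Fin 7) : RSpace 7 := EuclideanSpace.basisFun (Fin 7) ℝ i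

/-- The alternating sum of the values of a `7`-linear form on the standard basis of `ℝ⁷`. -/
noncomputable def altCoeff (f : MultilinearMap ℝ (fun _ : Fin 7 ↦ RSpace 7) ℝ) : ℝ :=
  ∑ σ : Equiv.Perm (Fin 7), (Equiv.Perm.sign σ : ℝ) * f (fun i ↦ stdVec (σ i))

theorem altCoeff_eq_alternatization (f : MultilinearMap ℝ (fun _ : Fin 7 ↦ RSpace 7) ℝ) :
    altCoeff f = MultilinearMap.alternatization f stdVec := by
  simp [altCoeff, MultilinearMap.alternatization_apply, Units.smul_def, stdVec]

/-- The alternatization is an alternating form of top degree, hence a multiple of the determinant in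
the standard basis. -/
theorem altCoeff_compLinearMap (f : MultilinearMap ℝ (fun _ : Fin 7 ↦ RSpace 7) ℝ)
    (A : RSpace 7 →ₗ[ℝ] RSpace 7) :
    altCoeff (f.compLinearMap fun _ ↦ A) = LinearMap.det A * altCoeff f := by
  have h : altCoeff (f.compLinearMap fun _ ↦ A) =
      MultilinearMap.alternatization f (A ∘ stdVec) := by
    simp [altCoeff, MultilinearMap.alternatization_apply, Units.smul_def]
  have h2 : (stdVec : Fin 7 → RSpace 7) = (EuclideanSpace.basisFun (Fin 7) ℝ).toBasis := by
    ext; simp [stdVec]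
  rw [h, altCoeff_eq_alternatization, h2,
    AlternatingMap.eq_smul_basis_det (EuclideanSpace.basisFun (Fin 7) ℝ).toBasis
      (MultilinearMap.alternatization f)]
  simp only [AlternatingMap.smul_apply, smul_eq_mul, Module.Basis.det_comp, Module.Basis.det_self]
  ring

/-- The `7`-linear form `c ⊗ a ⊗ b`. -/
noncomputable def tensor322 (c : (RSpace 7) [⋀^Fin 3]→L[ℝ] ℝ) (a b : (RSpace 7) [⋀^Fin 2]→L[ℝ] ℝ) :
    MultilinearMap ℝ (fun _ : Fin 7 ↦ RSpace 7) ℝ :=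
  formTensor c.toMultilinearMap (formTensor a.toMultilinearMap b.toMultilinearMap)

/-- The `7`-linear form `θ ⊗ b ⊗ a ⊗ a'`. -/
noncomputable def tensor1222 (θ : RSpace 7 →L[ℝ] ℝ) (b a a' : (RSpace 7) [⋀^Fin 2]→L[ℝ] ℝ) :
    MultilinearMap ℝ (fun _ : Fin 7 ↦ RSpace 7) ℝ :=
  formTensor (formTensor (MultilinearMap.ofSubsingleton ℝ (RSpace 7) ℝ (0 : Fin 1) θ.toLinearMap) b.toMultilinearMap)
    (formTensor a.toMultilinearMap a'.toMultilinearMap)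

theorem tensor322_apply (c : (RSpace 7) [⋀^Fin 3]→L[ℝ] ℝ) (a b : (RSpace 7) [⋀^Fin 2]→L[ℝ] ℝ)
    (v : Fin 7 → RSpace 7) :
    tensor322 c a b v = c ![v 0, v 1, v 2] * (a ![v 3, v 4] * b ![v 5, v 6]) := by
  refine (formTensor_apply _ _ _).trans ?_
  rw [formTensor_apply]
  refine congrArg₂ _ (congrArg c ?_) (congrArg₂ _ (congrArg a ?_) (congrArg b ?_)) <;>
  · ext i : 1
    fin_cases i <;> rfl

theorem tensor1222_apply (θ : RSpace 7 →L[ℝ] ℝ) (b a a' : (RSpace 7) [⋀^Fin 2]→L[ℝ] ℝ)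
    (v : Fin 7 → RSpace 7) :
    tensor1222 θ b a a' v = θ (v 0) * b ![v 1, v 2] * (a ![v 3, v 4] * a' ![v 5, v 6]) := by
  refine (formTensor_apply _ _ _).trans ?_
  rw [formTensor_apply, formTensor_apply]
  refine congrArg₂ _ (congrArg₂ _ ?_ (congrArg b ?_)) (congrArg₂ _ (congrArg a ?_) (congrArg a' ?_))
  · simp [Fin.castAdd]
  all_goals
    ext i : 1
    fin_cases i <;> rfl

theorem altCoeff_tensor322_comp (c : (RSpace 7) [⋀^Fin 3]→L[ℝ] ℝ)
    (a b : (RSpace 7) [⋀^Fin 2]→L[ℝ] ℝ) (L : RSpace 7 →L[ℝ] RSpace 7) :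
    altCoeff (tensor322 (c.compContinuousLinearMap L) (a.compContinuousLinearMap L)
      (b.compContinuousLinearMap L)) = L.det * altCoeff (tensor322 c a b) := by
  rw [ContinuousLinearMap.det, ← altCoeff_compLinearMap]
  congr 1

theorem altCoeff_tensor1222_comp (θ : RSpace 7 →L[ℝ] ℝ)
    (b a a' : (RSpace 7) [⋀^Fin 2]→L[ℝ] ℝ) (L : RSpace 7 →L[ℝ] RSpace 7) :
    altCoeff (tensor1222 (θ.comp L) (b.compContinuousLinearMap L) (a.compContinuousLinearMap L)
      (a'.compContinuousLinearMap L)) = L.det * altCoeff (tensor1222 θ b a a') := by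
  rw [ContinuousLinearMap.det, ← altCoeff_compLinearMap]
  congr 1

/-! ### Evaluation of alternating sums, and definiteness of `φ₀ ∧ i_u φ₀ ∧ i_u φ₀` -/

/-- The recursive expansion of an alternating sum over all permutations. -/
def altSum {α : Type*} : (n : ℕ) → (Fin n → α) → ((Fin n → α) → ℝ) → ℝ
  | 0, v, f => f v
  | n + 1, v, f => ∑ p : Fin (n + 1), (if p = 0 then 1 else -1) *
      altSum n (fun i ↦ v (Equiv.swap 0 p i.succ)) (fun w ↦ f (Fin.cons (v p) w))

/-- `Equiv.Perm.decomposeFin` factors a permutation into a transposition of `0` with `p` and a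
permutation of the remaining positions; the transposition contributes `-1` unless `p = 0`. Peeling
off one index at a time avoids expanding all 5040 terms. -/
theorem sum_perm_eq_altSum {α : Type*} (n : ℕ) (v : Fin n → α) (f : (Fin n → α) → ℝ) :
    ∑ σ : Equiv.Perm (Fin n), (Equiv.Perm.sign σ : ℝ) * f (fun i ↦ v (σ i)) = altSum n v f := by
  induction n with
  | zero =>
    simp only [altSum, Fintype.sum_unique]
    rw [Subsingleton.elim (fun i ↦ v _) v]
    simp
  | succ n ih =>
    rw [altSum, ← Equiv.Perm.decomposeFin.symm.sum_comp, Fintype.sum_prod_type]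
    refine Finset.sum_congr rfl fun p _ ↦ ?_
    rw [← ih, Finset.mul_sum]
    refine Finset.sum_congr rfl fun e _ ↦ ?_
    have h : (fun i ↦ v (Equiv.Perm.decomposeFin.symm (p, e) i)) =
        Fin.cons (v p) (fun i ↦ v (Equiv.swap 0 p (e i).succ)) := by
      ext i
      refine Fin.cases ?_ (fun i ↦ ?_) i <;> simp
    rw [h, Equiv.Perm.decomposeFin.symm_sign]
    split_ifs <;> simp

theorem altSum_add {α : Type*} (n : ℕ) (v : Fin n → α) (f g : (Fin n → α) → ℝ) :
    altSum n v (fun w ↦ f w + g w) = altSum n v f + altSum n v g := by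
  simp only [← sum_perm_eq_altSum, mul_add, Finset.sum_add_distrib]

theorem altSum_sub {α : Type*} (n : ℕ) (v : Fin n → α) (f g : (Fin n → α) → ℝ) :
    altSum n v (fun w ↦ f w - g w) = altSum n v f - altSum n v g := by
  simp only [← sum_perm_eq_altSum, mul_sub, Finset.sum_sub_distrib]

theorem altSum_zero {α : Type*} (n : ℕ) (v : Fin n → α) : altSum n v (fun _ ↦ 0) = 0 := by
  simp [← sum_perm_eq_altSum]

/-- By injectivity of `v`, only the branch that picks `x` first survives the indicator. -/
theorem altSum_ite_eq {α : Type*} [DecidableEq α] (n : ℕ) (v : Fin (n + 1) → α)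
    (hv : Function.Injective v) (p : Fin (n + 1)) (x : α) (hx : v p = x) (F : (Fin n → α) → ℝ) :
    altSum (n + 1) v (fun w ↦ if w 0 = x then F (fun i ↦ w i.succ) else 0) =
      (if p = 0 then 1 else -1) * altSum n (fun i ↦ v (Equiv.swap 0 p i.succ)) F := by
  subst hx
  rw [altSum, Finset.sum_eq_single p]
  · simp
  · intro q _ hq
    simp [hv.ne hq, altSum_zero]
  · simp

theorem dxForm_apply (i j k : Fin 7) (v : Fin 3 → RSpace 7) :
    dxForm i j k v =
      v 0 i * v 1 j * v 2 k - v 0 i * v 1 k * v 2 j - v 0 j * v 1 i * v 2 k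
      + v 0 k * v 1 i * v 2 j + v 0 j * v 1 k * v 2 i - v 0 k * v 1 j * v 2 i := by
  have : dxForm i j k v =
      Matrix.det (Matrix.of fun r s : Fin 3 ↦ v r (![i, j, k] s)) := rfl
  rw [this, Matrix.det_fin_three]
  simp
  ring

theorem dxForm_stdVec (i j k a b c : Fin 7) :
    dxForm i j k ![stdVec a, stdVec b, stdVec c] =
      (if a = i then if b = j then if c = k then 1 else 0 else 0 else 0)
      - (if a = i then if b = k then if c = j then 1 else 0 else 0 else 0)
      - (if a = j then if b = i then if c = k then 1 else 0 else 0 else 0)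
      + (if a = k then if b = i then if c = j then 1 else 0 else 0 else 0)
      + (if a = j then if b = k then if c = i then 1 else 0 else 0 else 0)
      - (if a = k then if b = j then if c = i then 1 else 0 else 0 else 0) := by
  rw [dxForm_apply]
  simp only [stdVec, EuclideanSpace.basisFun_apply, Matrix.cons_val, PiLp.single_apply,
    mul_ite, mul_one, mul_zero, ← ite_and, @eq_comm _ i, @eq_comm _ j, @eq_comm _ k]
  simp only [and_comm, and_assoc]

/-- Three uses of `altSum_ite_eq`. The positions `p, q, r` refer to the list of indices left after
the earlier transpositions, `ε` is the accumulated sign, and `hp` says that the untouched indices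
return to their original order. -/
theorem altSum_ite_eq₃ {α : Type*} [DecidableEq α] {n : ℕ} (v : Fin (n + 3) → α)
    (hv : Function.Injective v) (h : (Fin n → α) → ℝ) (p : Fin (n + 3)) (q : Fin (n + 2))
    (r : Fin (n + 1)) (a b c : α) (ε : ℤ) (ha : v p = a) (hb : v (Equiv.swap 0 p q.succ) = b)
    (hc : v (Equiv.swap 0 p (Equiv.swap 0 q r.succ).succ) = c)
    (hε : (if p = 0 then 1 else -1) * ((if q = 0 then 1 else -1) * (if r = 0 then 1 else -1)) = ε)
    (hp : ∀ i : Fin n, v (Equiv.swap 0 p (Equiv.swap 0 q (Equiv.swap 0 r i.succ).succ).succ) =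
      v i.succ.succ.succ) :
    altSum (n + 3) v (fun w ↦ if w 0 = a then if w (Fin.succ 0) = b then
      if w (Fin.succ (Fin.succ 0)) = c then h (fun i ↦ w i.succ.succ.succ) else 0 else 0 else 0) =
      ε * altSum n (fun i ↦ v i.succ.succ.succ) h := by
  have inj : ∀ {n : ℕ} (p : Fin (n + 1)),
      Function.Injective fun i : Fin n ↦ Equiv.swap 0 p i.succ := fun p ↦
    (Equiv.injective _).comp (Fin.succ_injective _)
  have h1 := altSum_ite_eq (n + 2) v hv p a ha (fun w ↦ if w 0 = b then
    if w (Fin.succ 0) = c then h (fun i ↦ w i.succ.succ) else 0 else 0)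
  have h2 := altSum_ite_eq (n + 1) _ (hv.comp (inj p)) q b hb (fun w ↦ if w 0 = c then
    h (fun i ↦ w i.succ) else 0)
  have h3 := altSum_ite_eq n _ (hv.comp ((inj p).comp (inj q))) r c hc (fun w ↦ h w)
  have h4 : (fun i : Fin n ↦ (v ∘ (fun i ↦ Equiv.swap 0 p i.succ) ∘ fun i ↦
      Equiv.swap 0 q i.succ) (Equiv.swap 0 r i.succ)) = fun i ↦ v i.succ.succ.succ := funext hp
  rw [h4] at h3
  refine h1.trans ?_
  rw [← hε]
  push_cast
  rw [mul_assoc, mul_assoc]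
  refine congrArg _ (h2.trans ?_)
  exact congrArg _ h3

/-- Each of the six terms of the `3 × 3` determinant selects one ordering of the indices `0, 1, 2`;
its coefficient cancels the sign of that ordering, so all six contribute equally. -/
theorem altSum_dxForm_mul (h : (Fin 4 → Fin 7) → ℝ) :
    altSum 7 id (fun w ↦ dxForm 0 1 2
      ![stdVec (w 0), stdVec (w (Fin.succ 0)), stdVec (w (Fin.succ (Fin.succ 0)))] *
      h (fun i ↦ w i.succ.succ.succ)) = 6 * altSum 4 (fun i ↦ id i.succ.succ.succ) h := by
  have inj := Function.injective_id (α := Fin 7)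
  simp only [dxForm_stdVec, add_mul, sub_mul, ite_mul, one_mul, zero_mul, altSum_add, altSum_sub]
  rw [altSum_ite_eq₃ _ inj h 0 0 0 0 1 2 1 rfl (by decide) (by decide) (by decide) (by decide),
    altSum_ite_eq₃ _ inj h 0 1 0 0 2 1 (-1) rfl (by decide) (by decide) (by decide) (by decide),
    altSum_ite_eq₃ _ inj h 1 0 0 1 0 2 (-1) rfl (by decide) (by decide) (by decide) (by decide),
    altSum_ite_eq₃ _ inj h 2 1 0 2 0 1 1 rfl (by decide) (by decide) (by decide) (by decide),
    altSum_ite_eq₃ _ inj h 1 1 0 1 2 0 1 rfl (by decide) (by decide) (by decide) (by decide),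
    altSum_ite_eq₃ _ inj h 2 0 0 2 1 0 (-1) rfl (by decide) (by decide) (by decide) (by decide)]
  push_cast
  ring

/-- The alternating sum of a product with `dx_{ijk}` is an alternating sum over the permutations
of the four complementary indices. -/
theorem sum_perm_dxForm_mul (π : Equiv.Perm (Fin 7)) (h : (Fin 4 → Fin 7) → ℝ) :
    ∑ σ : Equiv.Perm (Fin 7), (Equiv.Perm.sign σ : ℝ) *
      (dxForm (π 0) (π 1) (π 2) ![stdVec (σ 0), stdVec (σ 1), stdVec (σ 2)] *
        h (fun i ↦ σ i.succ.succ.succ)) =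
      Equiv.Perm.sign π * (6 * altSum 4 (fun i ↦ π i.succ.succ.succ) h) := by
  have h1 := sum_perm_eq_altSum 7 id fun w ↦ dxForm 0 1 2
      ![stdVec (w 0), stdVec (w (Fin.succ 0)), stdVec (w (Fin.succ (Fin.succ 0)))] *
      h (fun i ↦ π (w i.succ.succ.succ))
  rw [altSum_dxForm_mul (fun w ↦ h fun i ↦ π (w i))] at h1
  have h2 : altSum 4 (fun i ↦ id i.succ.succ.succ) (fun w ↦ h fun i ↦ π (w i)) =
      altSum 4 (fun i ↦ π i.succ.succ.succ) h := by
    rw [← sum_perm_eq_altSum, ← sum_perm_eq_altSum]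
    rfl
  -- The substitution `σ ↦ πσ` relabels the basis vectors, reducing to `dx` with indices `0, 1, 2`
  -- at the cost of the sign of `π`.
  rw [← h2, ← h1, Finset.mul_sum, ← Equiv.sum_comp (Equiv.mulLeft π)]
  refine Finset.sum_congr rfl fun σ _ ↦ ?_
  simp only [Equiv.coe_mulLeft, Equiv.Perm.sign_mul, dxForm_stdVec, Equiv.Perm.mul_apply,
    EmbeddingLike.apply_eq_iff_eq, id_eq]
  push_cast
  ring

/-- The 24 permutations fall into three pairings of the four indices. Each pairing occurs `2·2·2 =
8` times, with equal signed values: flip either pair, or exchange the two factors. -/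
theorem altSum_four_mul {α : Type*} (a : α → α → ℝ) (ha : ∀ i j, a i j = -a j i)
    (w : Fin 4 → α) :
    altSum 4 w (fun w ↦ a (w 0) (w 1) * a (w 2) (w 3)) =
      8 * (a (w 0) (w 1) * a (w 2) (w 3) - a (w 0) (w 2) * a (w 1) (w 3) +
        a (w 0) (w 3) * a (w 1) (w 2)) := by
  simp only [altSum, Fin.sum_univ_succ, Equiv.swap_apply_def, Finset.univ_unique,
    Finset.sum_singleton]
  have h2 : ∀ (x y : α) (f : Fin 2 → α), (Fin.cons x (Fin.cons y f) : Fin 4 → α) 2 = f 0 :=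
    fun _ _ _ ↦ rfl
  have h3 : ∀ (x y : α) (f : Fin 2 → α), (Fin.cons x (Fin.cons y f) : Fin 4 → α) 3 = f 1 :=
    fun _ _ _ ↦ rfl
  simp [Fin.ext_iff, h2, h3]
  rw [ha (w 1) (w 0), ha (w 2) (w 0), ha (w 3) (w 0), ha (w 2) (w 1), ha (w 3) (w 1),
    ha (w 3) (w 2)]
  ring

/-- The Pfaffian of the entries of `a` with indices among `i, j, k, l`. -/
def pfaffian₄ {α : Type*} (a : α → α → ℝ) (i j k l : α) : ℝ :=
  a i j * a k l - a i k * a j l + a i l * a j k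

/-- Here `48 = 6·8`. The permutation is passed as a function with an explicit inverse, so that its
validity and sign can be decided for concrete vectors. -/
theorem sum_perm_dxForm_mul_mul (f g : Fin 7 → Fin 7) (hfg : Function.LeftInverse g f)
    (hgf : Function.RightInverse g f) (hs : Equiv.Perm.sign ⟨f, g, hfg, hgf⟩ = 1)
    (a : Fin 7 → Fin 7 → ℝ) (ha : ∀ i j, a i j = -a j i) :
    ∑ σ : Equiv.Perm (Fin 7), (Equiv.Perm.sign σ : ℝ) *
      (dxForm (f 0) (f 1) (f 2) ![stdVec (σ 0), stdVec (σ 1), stdVec (σ 2)] *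
        (a (σ 3) (σ 4) * a (σ 5) (σ 6))) = 48 * pfaffian₄ a (f 3) (f 4) (f 5) (f 6) := by
  have h := sum_perm_dxForm_mul ⟨f, g, hfg, hgf⟩ fun w ↦ a (w 0) (w 1) * a (w 2) (w 3)
  rw [hs, altSum_four_mul a ha] at h
  refine h.trans ?_
  simp only [Units.val_one, Int.cast_one, pfaffian₄]
  simp only [Equiv.coe_fn_mk]
  change 1 * (6 * (8 * (a (f 3) (f 4) * a (f 5) (f 6) - a (f 3) (f 5) * a (f 4) (f 6) +
    a (f 3) (f 6) * a (f 4) (f 5)))) = _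
  ring

theorem ContinuousAlternatingMap.apply_vecCons_swap {E : Type*} [NormedAddCommGroup E]
    [NormedSpace ℝ E] (a : E [⋀^Fin 2]→L[ℝ] ℝ) (x y : E) : a ![x, y] = -a ![y, x] := by
  have h := a.map_swap ![y, x] (i := 0) (j := 1) (by decide)
  refine Eq.trans (congrArg a ?_) h
  ext i : 1
  fin_cases i <;> simp

/-- Each monomial of `φ₀` pairs with the Pfaffian on its four complementary indices. Triple followed
by increasing complement is an even permutation in all seven cases, so the signs are those of `φ₀`;
the result is the pattern of the Hodge dual `∗φ₀`. -/
theorem altCoeff_tensor322_phi0 (a : (RSpace 7) [⋀^Fin 2]→L[ℝ] ℝ) :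
    altCoeff (tensor322 phi0 a a) =
      48 * (pfaffian₄ (fun i j ↦ a ![stdVec i, stdVec j]) 3 4 5 6 +
        pfaffian₄ (fun i j ↦ a ![stdVec i, stdVec j]) 1 2 5 6 +
        pfaffian₄ (fun i j ↦ a ![stdVec i, stdVec j]) 1 2 3 4 +
        pfaffian₄ (fun i j ↦ a ![stdVec i, stdVec j]) 0 2 4 6 -
        pfaffian₄ (fun i j ↦ a ![stdVec i, stdVec j]) 0 2 3 5 -
        pfaffian₄ (fun i j ↦ a ![stdVec i, stdVec j]) 0 1 4 5 -
        pfaffian₄ (fun i j ↦ a ![stdVec i, stdVec j]) 0 1 3 6) := by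
  have key := fun f g hfg hgf hs ↦ sum_perm_dxForm_mul_mul f g hfg hgf hs
    (fun i j ↦ a ![stdVec i, stdVec j]) fun _ _ ↦ a.apply_vecCons_swap _ _
  have k1 := key ![0, 1, 2, 3, 4, 5, 6] ![0, 1, 2, 3, 4, 5, 6] (by decide) (by decide)
    (by decide +kernel)
  have k2 := key ![0, 3, 4, 1, 2, 5, 6] ![0, 3, 4, 1, 2, 5, 6] (by decide) (by decide)
    (by decide +kernel)
  have k3 := key ![0, 5, 6, 1, 2, 3, 4] ![0, 3, 4, 5, 6, 1, 2] (by decide) (by decide)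
    (by decide +kernel)
  have k4 := key ![1, 3, 5, 0, 2, 4, 6] ![3, 0, 4, 1, 5, 2, 6] (by decide) (by decide)
    (by decide +kernel)
  have k5 := key ![1, 4, 6, 0, 2, 3, 5] ![3, 0, 4, 5, 1, 6, 2] (by decide) (by decide)
    (by decide +kernel)
  have k6 := key ![2, 3, 6, 0, 1, 4, 5] ![3, 4, 0, 1, 5, 6, 2] (by decide) (by decide)
    (by decide +kernel)
  have k7 := key ![2, 4, 5, 0, 1, 3, 6] ![3, 4, 0, 5, 1, 2, 6] (by decide) (by decide)
    (by decide +kernel)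
  simp only [Matrix.cons_val] at k1 k2 k3 k4 k5 k6 k7
  simp only [altCoeff, tensor322_apply, phi0, ContinuousAlternatingMap.add_apply,
    ContinuousAlternatingMap.sub_apply, add_mul, sub_mul, mul_add, mul_sub,
    Finset.sum_add_distrib, Finset.sum_sub_distrib]
  rw [k1, k2, k3, k4, k5, k6, k7]

/-- This is `φ₀ ∧ i_u φ₀ ∧ i_u φ₀ = 6 |u|² vol`, with `144 = 6 · 3!·2!·2!`. After the entries of
`i_u φ₀` are read off, it is a polynomial identity in the coordinates of `u`. -/
theorem altCoeff_tensor322_phi0_curryLeft (u : RSpace 7) :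
    altCoeff (tensor322 phi0 (phi0.curryLeft u) (phi0.curryLeft u)) = 144 * ‖u‖ ^ 2 := by
  rw [altCoeff_tensor322_phi0, EuclideanSpace.norm_sq_eq]
  have hdx : ∀ i j k a b : Fin 7, dxForm i j k ![u, stdVec a, stdVec b] =
      (if a = j ∧ b = k then u i else 0) - (if a = k ∧ b = j then u i else 0)
      - (if a = i ∧ b = k then u j else 0) + (if a = i ∧ b = j then u k else 0)
      + (if a = k ∧ b = i then u j else 0) - (if a = j ∧ b = i then u k else 0) := by
    intro i j k a b
    rw [dxForm_apply]
    simp only [stdVec, EuclideanSpace.basisFun_apply, Matrix.cons_val, PiLp.single_apply,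
      mul_ite, mul_one, mul_zero, ← ite_and, @eq_comm _ i, @eq_comm _ j, @eq_comm _ k]
    simp only [and_comm]
  simp only [ContinuousAlternatingMap.curryLeft_apply_apply]
  simp only [pfaffian₄, phi0, ContinuousAlternatingMap.add_apply,
    ContinuousAlternatingMap.sub_apply, hdx, Fin.reduceEq, and_self, and_true, and_false,
    if_true, if_false, Real.norm_eq_abs, sq_abs, Fin.sum_univ_seven]
  ring

/-- For a form `φ` in the orbit of `φ₀` the coefficient of `φ ∧ i_u φ ∧ i_u φ` is definite
in `u`. -/
theorem altCoeff_tensor322_of_phi0_comp (A : RSpace 7 →L[ℝ] RSpace 7) (u : RSpace 7) :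
    altCoeff (tensor322 (phi0.compContinuousLinearMap A)
      ((phi0.compContinuousLinearMap A).curryLeft u)
      ((phi0.compContinuousLinearMap A).curryLeft u)) = A.det * (144 * ‖A u‖ ^ 2) := by
  rw [← altCoeff_tensor322_phi0_curryLeft, ← altCoeff_tensor322_comp,
    ContinuousAlternatingMap.curryLeft_compContinuousLinearMap]

end AlternatingSums

/-! ### Cartan's formula on `ℝⁿ` -/

section ExteriorCalculus

theorem two_le_contDiff_infty : (2 : ℕ∞ω) ≤ ∞ :=
  WithTop.coe_le_coe.2 (le_top : (2 : ℕ∞) ≤ ⊤)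

/-- The product rule for the continuous bilinear contraction. -/
theorem hasFDerivAt_curryLeft_apply {E : Type*} [NormedAddCommGroup E] [NormedSpace ℝ E] {k : ℕ}
    {η : E → E [⋀^Fin (k + 1)]→L[ℝ] ℝ} {V : E → E} {y : E} (hη : DifferentiableAt ℝ η y)
    (hV : DifferentiableAt ℝ V y) :
    DifferentiableAt ℝ (fun z ↦ (η z).curryLeft (V z)) y ∧ ∀ w,
      fderiv ℝ (fun z ↦ (η z).curryLeft (V z)) y w =
        (fderiv ℝ η y w).curryLeft (V y) + (η y).curryLeft (fderiv ℝ V y w) := by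
  let C := (ContinuousAlternatingMap.curryLeftLI (𝕜 := ℝ) (E := E) (F := ℝ)
    (n := k)).toContinuousLinearMap
  have h1 : HasFDerivAt (fun z ↦ C (η z)) (C.comp (fderiv ℝ η y)) y :=
    HasFDerivAt.comp (g := C) y C.hasFDerivAt hη.hasFDerivAt
  have h2 := h1.clm_apply hV.hasFDerivAt
  refine ⟨h2.differentiableAt, fun w ↦ ?_⟩
  have h3 : fderiv ℝ (fun z ↦ (η z).curryLeft (V z)) y = _ := h2.fderiv
  rw [h3, add_comm]
  rfl

/-- Cartan's formula in coordinates. -/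
theorem extDeriv_curryLeft {n k : ℕ} {η : RSpace n → (RSpace n) [⋀^Fin (k + 1)]→L[ℝ] ℝ}
    {V : RSpace n → RSpace n} {y : RSpace n} (hη : DifferentiableAt ℝ η y)
    (hV : DifferentiableAt ℝ V y) :
    extDeriv (fun z ↦ (η z).curryLeft (V z)) y =
      lieDerivCoord V η y - (extDeriv η y).curryLeft (V y) := by
  ext v
  rw [ContinuousAlternatingMap.sub_apply, lieDerivCoord_apply,
    ContinuousAlternatingMap.curryLeft_apply_apply, extDeriv, extDeriv,
    ContinuousAlternatingMap.alternatizeUncurryFin_apply,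
    ContinuousAlternatingMap.alternatizeUncurryFin_apply, Fin.sum_univ_succ (n := k + 1)]
  -- In `dη(V, v₁, …)` the term omitting `V` is `D_V η`, and the others cancel the terms of `d(i_V
  -- η)` in which `η` is differentiated. The terms in which `V` is differentiated become those of
  -- the Lie derivative once `D_{v_i} V` is moved to the first slot, with sign `(-1)^i`.
  have h0 : Fin.removeNth 0 (Matrix.vecCons (V y) v) = v := by
    ext i : 1; simp [Fin.removeNth]
  have h1 : ∀ i : Fin (k + 1), Fin.removeNth i.succ (Matrix.vecCons (V y) v) =
      Matrix.vecCons (V y) (Fin.removeNth i v) := by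
    intro i
    ext j : 1
    refine Fin.cases ?_ (fun j ↦ ?_) j <;> simp [Fin.removeNth]
  have h2 : ∀ i : Fin (k + 1), η y (Function.update v i (fderiv ℝ V y (v i))) =
      (-1 : ℤ) ^ i.val • η y (Matrix.vecCons (fderiv ℝ V y (v i)) (Fin.removeNth i v)) := by
    intro i
    have := (η y).toAlternatingMap.map_insertNth i (fderiv ℝ V y (v i)) (i.removeNth v)
    rw [Fin.insertNth_removeNth] at this
    exact this
  simp only [h0, h1, h2, Matrix.cons_val_zero, Matrix.cons_val_succ,
    (hasFDerivAt_curryLeft_apply hη hV).2, ContinuousAlternatingMap.add_apply,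
    ContinuousAlternatingMap.curryLeft_apply_apply, smul_add, Finset.sum_add_distrib, Fin.val_zero,
    pow_zero, one_smul, Fin.val_succ, pow_succ, mul_neg, mul_one, neg_smul, Finset.sum_neg_distrib]
  ring

end ExteriorCalculus

/-! ### Chart changes, and the calculus of forms and vector fields in charts -/

section Charts

variable {n k : ℕ} {M : Type*} [TopologicalSpace M] [ChartedSpace (RSpace n) M]

section
variable [IsManifold (𝓡 n) ∞ M]

theorem mdifferentiableAt_extChartAt_symm' {x₀ : M} {y : RSpace n}
    (hy : y ∈ (extChartAt (𝓡 n) x₀).target) :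
    MDifferentiableAt 𝓘(ℝ, RSpace n) (𝓡 n) (extChartAt (𝓡 n) x₀).symm y := by
  have : IsManifold (𝓡 n) 1 M := .of_le (n := ∞) (by simp)
  simpa [mdifferentiableWithinAt_univ] using mdifferentiableWithinAt_extChartAt_symm hy

theorem isInvertible_mfderiv_extChartAt_symm' {x₀ : M} {y : RSpace n}
    (hy : y ∈ (extChartAt (𝓡 n) x₀).target) :
    (mfderiv 𝓘(ℝ, RSpace n) (𝓡 n) (extChartAt (𝓡 n) x₀).symm y).IsInvertible := by
  have : IsManifold (𝓡 n) 1 M := .of_le (n := ∞) (by simp)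
  simpa [mfderivWithin_univ] using isInvertible_mfderivWithin_extChartAt_symm hy

/-- The change of coordinates from the preferred chart at `x₀` to the one at `x₁`. -/
noncomputable def chartChange (x₀ x₁ : M) : RSpace n → RSpace n :=
  fun y ↦ extChartAt (𝓡 n) x₁ ((extChartAt (𝓡 n) x₀).symm y)

/-- The part of the target of the chart at `x₀` covered by the chart at `x₁`. -/
def chartOverlap (x₀ x₁ : M) : Set (RSpace n) :=
  (extChartAt (𝓡 n) x₀).target ∩ (extChartAt (𝓡 n) x₀).symm ⁻¹' (extChartAt (𝓡 n) x₁).source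

omit [IsManifold (𝓡 n) ∞ M] in
theorem isOpen_chartOverlap (x₀ x₁ : M) : IsOpen (chartOverlap (n := n) x₀ x₁) :=
  (continuousOn_extChartAt_symm x₀).isOpen_inter_preimage (isOpen_extChartAt_target x₀)
    (isOpen_extChartAt_source x₁)

theorem contDiffOn_chartChange (x₀ x₁ : M) :
    ContDiffOn ℝ ∞ (chartChange (n := n) x₀ x₁) (chartOverlap x₀ x₁) := by
  have := contDiffOn_ext_coord_change (I := 𝓡 n) (n := ∞) x₁ x₀
  rwa [PartialEquiv.trans_source, PartialEquiv.symm_source] at this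

theorem contDiffAt_chartChange {x₀ x₁ : M} {y : RSpace n} (hy : y ∈ chartOverlap x₀ x₁) :
    ContDiffAt ℝ ∞ (chartChange (n := n) x₀ x₁) y :=
  (contDiffOn_chartChange x₀ x₁).contDiffAt ((isOpen_chartOverlap x₀ x₁).mem_nhds hy)

omit [IsManifold (𝓡 n) ∞ M] in
theorem symm_chartChange {x₀ x₁ : M} {y : RSpace n} (hy : y ∈ chartOverlap x₀ x₁) :
    (extChartAt (𝓡 n) x₁).symm (chartChange x₀ x₁ y) = (extChartAt (𝓡 n) x₀).symm y :=
  (extChartAt (𝓡 n) x₁).left_inv hy.2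

omit [IsManifold (𝓡 n) ∞ M] in
theorem chartChange_mem {x₀ x₁ : M} {y : RSpace n} (hy : y ∈ chartOverlap x₀ x₁) :
    chartChange x₀ x₁ y ∈ chartOverlap x₁ x₀ := by
  refine ⟨(extChartAt (𝓡 n) x₁).map_source hy.2, ?_⟩
  rw [Set.mem_preimage, symm_chartChange hy]
  exact (extChartAt (𝓡 n) x₀).map_target hy.1

omit [IsManifold (𝓡 n) ∞ M] in
theorem chartChange_chartChange {x₀ x₁ : M} {y : RSpace n} (hy : y ∈ chartOverlap x₀ x₁) :
    chartChange x₁ x₀ (chartChange x₀ x₁ y) = y := by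
  rw [chartChange, symm_chartChange hy, (extChartAt (𝓡 n) x₀).right_inv hy.1]

theorem mfderiv_symm_comp_fderiv_chartChange {x₀ x₁ : M} {y : RSpace n}
    (hy : y ∈ chartOverlap x₀ x₁) :
    (mfderiv 𝓘(ℝ, RSpace n) (𝓡 n) (extChartAt (𝓡 n) x₁).symm (chartChange x₀ x₁ y) :
      RSpace n →L[ℝ] RSpace n) ∘L fderiv ℝ (chartChange x₀ x₁) y =
    mfderiv 𝓘(ℝ, RSpace n) (𝓡 n) (extChartAt (𝓡 n) x₀).symm y := by
  have h1 : (extChartAt (𝓡 n) x₁).symm ∘ chartChange x₀ x₁ =ᶠ[nhds y]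
      (extChartAt (𝓡 n) x₀).symm := by
    filter_upwards [(isOpen_chartOverlap x₀ x₁).mem_nhds hy] with z hz
    exact symm_chartChange hz
  have h2 := mfderiv_comp y (mdifferentiableAt_extChartAt_symm' (chartChange_mem hy).1)
    ((contDiffAt_chartChange hy).differentiableAt (by simp)).mdifferentiableAt
  rw [mfderiv_eq_fderiv, h1.mfderiv_eq] at h2
  exact h2.symm

theorem DiffForm.inChart_eq_comp (α : DiffForm n k M) {x₀ x₁ : M} {y : RSpace n}
    (hy : y ∈ chartOverlap x₀ x₁) :
    α.inChart x₀ y = (α.inChart x₁ (chartChange x₀ x₁ y)).compContinuousLinearMap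
      (fderiv ℝ (chartChange x₀ x₁) y) := by
  -- The two base points are only propositionally equal, so the forms at them are compared in the
  -- common model space.
  have key : ∀ (p q : M) (_ : p = q) (A : RSpace n →L[ℝ] RSpace n),
      ContinuousAlternatingMap.compContinuousLinearMap
        (α p : (RSpace n) [⋀^Fin k]→L[ℝ] ℝ) A =
      ContinuousAlternatingMap.compContinuousLinearMap
        (α q : (RSpace n) [⋀^Fin k]→L[ℝ] ℝ) A := by
    rintro p q rfl A
    rfl
  refine (key _ _ (symm_chartChange hy).symm _).trans ?_
  rw [← mfderiv_symm_comp_fderiv_chartChange hy]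
  rfl

/-- At each point `p` the derivative `α.d` is computed in the preferred chart of `p`, not in that of
`x₀`. The two agree because `extDeriv` commutes with pullback along the chart change. -/
theorem DiffForm.d_inChart {α : DiffForm n k M} (hα : α.IsSmooth) {x₀ : M} {y : RSpace n}
    (hy : y ∈ (extChartAt (𝓡 n) x₀).target) :
    α.d.inChart x₀ y = extDeriv (α.inChart x₀) y := by
  set p := (extChartAt (𝓡 n) x₀).symm y with hp
  have hyp : y ∈ chartOverlap x₀ p := ⟨hy, mem_extChartAt_source p⟩
  have h1 : α.inChart x₀ =ᶠ[nhds y] fun z ↦ (α.inChart p (chartChange x₀ p z)).compContinuousLinearMap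
      (fderiv ℝ (chartChange x₀ p) z) := by
    filter_upwards [(isOpen_chartOverlap x₀ p).mem_nhds hyp] with z hz
    exact α.inChart_eq_comp hz
  have h2 : DifferentiableAt ℝ (α.inChart p) (chartChange x₀ p y) :=
    ((hα p).contDiffAt ((isOpen_extChartAt_target p).mem_nhds
      (chartChange_mem hyp).1)).differentiableAt (by simp)
  rw [h1.extDeriv_eq, extDeriv_pullback h2 (contDiffAt_chartChange hyp)
    (minSmoothness_of_isRCLikeNormedField.trans_le two_le_contDiff_infty)]
  have : IsManifold (𝓡 n) 1 M := .of_le (n := ∞) (by simp)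
  have h3 := mfderiv_comp (f := (extChartAt (𝓡 n) x₀).symm) y
    (mdifferentiableAt_extChartAt (I := 𝓡 n) (mem_chart_source (RSpace n) p))
    (mdifferentiableAt_extChartAt_symm' hy)
  have h4 : mfderiv 𝓘(ℝ, RSpace n) 𝓘(ℝ, RSpace n)
    (extChartAt (𝓡 n) p ∘ (extChartAt (𝓡 n) x₀).symm) y = fderiv ℝ (chartChange x₀ p) y :=
    mfderiv_eq_fderiv
  rw [h4.symm.trans h3]
  rfl

/-- The contraction of a form with a vector field. -/
noncomputable def DiffForm.contract (X : (x : M) → TangentSpace (𝓡 n) x)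
    (α : DiffForm n (k + 1) M) : DiffForm n k M := fun x ↦
  ContinuousAlternatingMap.curryLeft (𝕜 := ℝ) (E := RSpace n) (F := ℝ) (n := k) (α x) (X x)

/-- The expression of a vector field in the preferred chart around `x₀`. -/
noncomputable def vectorFieldInChart (X : (x : M) → TangentSpace (𝓡 n) x) (x₀ : M) :
    RSpace n → RSpace n :=
  VectorField.mpullback 𝓘(ℝ, RSpace n) (𝓡 n) (extChartAt (𝓡 n) x₀).symm X

theorem mfderiv_vectorFieldInChart (X : (x : M) → TangentSpace (𝓡 n) x) {x₀ : M} {y : RSpace n}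
    (hy : y ∈ (extChartAt (𝓡 n) x₀).target) :
    mfderiv 𝓘(ℝ, RSpace n) (𝓡 n) (extChartAt (𝓡 n) x₀).symm y (vectorFieldInChart X x₀ y) =
      X ((extChartAt (𝓡 n) x₀).symm y) := by
  obtain ⟨A, hA⟩ := isInvertible_mfderiv_extChartAt_symm' hy
  rw [vectorFieldInChart, VectorField.mpullback_apply, ← hA, ContinuousLinearMap.inverse_equiv]
  exact A.apply_symm_apply _

theorem contDiffOn_vectorFieldInChart {X : (x : M) → TangentSpace (𝓡 n) x}
    (hX : IsSmoothVectorField X) (x₀ : M) :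
    ContDiffOn ℝ ∞ (vectorFieldInChart X x₀) (extChartAt (𝓡 n) x₀).target := by
  intro y hy
  have : IsManifold (𝓡 n) 1 M := .of_le (n := ∞) (by simp)
  have h1 : ContMDiffAt 𝓘(ℝ, RSpace n) (𝓡 n) ∞ (extChartAt (𝓡 n) x₀).symm y :=
    (contMDiffOn_extChartAt_symm x₀).contMDiffAt ((isOpen_extChartAt_target x₀).mem_nhds hy)
  have h2 := ContMDiffAt.mpullback_vectorField_preimage (m := ∞) (n := ∞)
    (hX ((extChartAt (𝓡 n) x₀).symm y)) h1 (isInvertible_mfderiv_extChartAt_symm' hy) (by simp)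
  exact (contMDiffAt_vectorSpace_iff_contDiffAt.1 h2).contDiffWithinAt

theorem DiffForm.contract_inChart (X : (x : M) → TangentSpace (𝓡 n) x)
    (α : DiffForm n (k + 1) M) {x₀ : M} {y : RSpace n}
    (hy : y ∈ (extChartAt (𝓡 n) x₀).target) :
    (α.contract X).inChart x₀ y = (α.inChart x₀ y).curryLeft (vectorFieldInChart X x₀ y) := by
  have h := ContinuousAlternatingMap.curryLeft_compContinuousLinearMap (𝕜 := ℝ) (E := RSpace n)
    (F := RSpace n) (G := ℝ) (n := k) (α ((extChartAt (𝓡 n) x₀).symm y))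
    (mfderiv 𝓘(ℝ, RSpace n) (𝓡 n) (extChartAt (𝓡 n) x₀).symm y)
    (vectorFieldInChart X x₀ y)
  refine Eq.trans ?_ h.symm
  exact congrArg (fun u ↦ ContinuousAlternatingMap.compContinuousLinearMap
    (ContinuousAlternatingMap.curryLeft (𝕜 := ℝ) (E := RSpace n) (F := ℝ) (n := k)
      (α ((extChartAt (𝓡 n) x₀).symm y)) u)
    (mfderiv 𝓘(ℝ, RSpace n) (𝓡 n) (extChartAt (𝓡 n) x₀).symm y))
    (mfderiv_vectorFieldInChart X hy).symm

theorem DiffForm.IsSmooth.contract {X : (x : M) → TangentSpace (𝓡 n) x}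
    (hX : IsSmoothVectorField X) {α : DiffForm n (k + 1) M} (hα : α.IsSmooth) :
    (α.contract X).IsSmooth := by
  intro x₀
  have h : ContDiffOn ℝ ∞ (fun y ↦ (α.inChart x₀ y).curryLeft (vectorFieldInChart X x₀ y))
      (extChartAt (𝓡 n) x₀).target :=
    ContDiffOn.clm_apply (f := fun y ↦ ContinuousAlternatingMap.curryLeftLI (𝕜 := ℝ)
      (E := RSpace n) (F := ℝ) (n := k) (α.inChart x₀ y))
      ((LinearIsometry.contDiff _).comp_contDiffOn (hα x₀)) (contDiffOn_vectorFieldInChart hX x₀)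
  exact h.congr fun y hy ↦ α.contract_inChart X hy

/-- If `α` is exact and `L_X α = 0`, then `i_X α` is closed. -/
theorem DiffForm.d_contract_eq_zero {X : (x : M) → TangentSpace (𝓡 n) x}
    (hX : IsSmoothVectorField X) {β : DiffForm n k M} (hβ : β.IsSmooth) (hdβ : β.d.IsSmooth)
    (h : DiffForm.lieDeriv X β.d = 0) : (β.d.contract X).d = 0 := by
  funext x
  have hx := mem_extChartAt_target (I := 𝓡 n) x
  have hnhds := (isOpen_extChartAt_target (I := 𝓡 n) x).mem_nhds hx
  have h1 : (β.d.contract X).inChart x =ᶠ[nhds (extChartAt (𝓡 n) x x)]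
      fun y ↦ (β.d.inChart x y).curryLeft (vectorFieldInChart X x y) := by
    filter_upwards [hnhds] with y hy
    exact β.d.contract_inChart X hy
  have h2 : β.d.inChart x =ᶠ[nhds (extChartAt (𝓡 n) x x)] extDeriv (β.inChart x) := by
    filter_upwards [hnhds] with y hy
    exact DiffForm.d_inChart hβ hy
  -- Exactness enters here only through `d(dβ) = 0`, which removes the second term of Cartan's
  -- formula.
  have h3 : extDeriv (β.d.inChart x) (extChartAt (𝓡 n) x x) = 0 := by
    rw [h2.extDeriv_eq, extDeriv_extDeriv_apply ((hβ x).contDiffAt hnhds)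
      (minSmoothness_of_isRCLikeNormedField.trans_le two_le_contDiff_infty)]
  have h4 := extDeriv_curryLeft (((hdβ x).contDiffAt hnhds).differentiableAt (by simp))
    (((contDiffOn_vectorFieldInChart hX x).contDiffAt hnhds).differentiableAt (by simp))
  have h5 : extDeriv ((β.d.contract X).inChart x) (extChartAt (𝓡 n) x x) =
      lieDerivCoord (vectorFieldInChart X x) (β.d.inChart x) (extChartAt (𝓡 n) x x) := by
    rw [h1.extDeriv_eq, h4, h3]
    ext v
    simp
  refine Eq.trans ?_ (congrFun h x)
  exact congrArg (chartPullbackAt x) h5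

end
end Charts

/-! ### Divergence theorem and Leibniz' rule in coordinates -/

section Divergence

/-- A continuous function on an open set vanishing outside a compact subset is integrable. -/
theorem integrableOn_of_eq_zero_off_compact {n : ℕ} {U K : Set (RSpace n)} (hU : IsOpen U)
    (hK : IsCompact K) (hKU : K ⊆ U) {f : RSpace n → ℝ} (hf : ContinuousOn f U)
    (h0 : ∀ y ∈ U \ K, f y = 0) : MeasureTheory.IntegrableOn f U :=
  ((hf.mono hKU).integrableOn_compact hK).of_forall_sdiff_eq_zero hU.measurableSet h0

/-- The integral of a directional derivative of a compactly supported function vanishes. -/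
theorem integral_fderiv_eq_zero_of_eq_zero_off_compact {n : ℕ} {U K : Set (RSpace n)}
    (hU : IsOpen U) (hK : IsCompact K) (hKU : K ⊆ U) {f : RSpace n → ℝ} (hf : ContDiffOn ℝ 1 f U)
    (h0 : ∀ y ∈ U \ K, f y = 0) (v : RSpace n) :
    MeasureTheory.IntegrableOn (fun y ↦ fderiv ℝ f y v) U ∧ ∫ y in U, fderiv ℝ f y v = 0 := by
  -- Extension by zero gives a globally `C¹` function with compact support.
  set g := U.indicator f with hg
  have gU : ∀ y ∈ U, g =ᶠ[nhds y] f := fun y hy ↦ by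
    filter_upwards [hU.mem_nhds hy] with z hz using Set.indicator_of_mem hz f
  have gK : ∀ y ∉ K, g =ᶠ[nhds y] fun _ ↦ 0 := fun y hy ↦ by
    filter_upwards [hK.isClosed.isOpen_compl.mem_nhds hy] with z hz
    by_cases hzU : z ∈ U
    · rw [hg, Set.indicator_of_mem hzU, h0 z ⟨hzU, hz⟩]
    · exact Set.indicator_of_notMem hzU f
  have gsmooth : ContDiff ℝ 1 g := contDiff_iff_contDiffAt.2 fun y ↦ by
    by_cases hy : y ∈ K
    · exact ((hf.contDiffAt (hU.mem_nhds (hKU hy)))).congr_of_eventuallyEq (gU y (hKU hy))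
    · exact contDiffAt_const.congr_of_eventuallyEq (gK y hy)
  have gcomp : HasCompactSupport g :=
    HasCompactSupport.intro hK fun y hy ↦ (gK y hy).eq_of_nhds
  have dgcomp : HasCompactSupport fun y ↦ fderiv ℝ g y v :=
    HasCompactSupport.intro hK fun y hy ↦ by simp [(gK y hy).fderiv_eq]
  have dgcont : Continuous fun y ↦ fderiv ℝ g y v :=
    (gsmooth.continuous_fderiv one_ne_zero).clm_apply continuous_const
  have dgint := dgcont.integrable_of_hasCompactSupport (μ := MeasureTheory.volume) dgcomp
  have h1 : ∀ y ∈ U, fderiv ℝ g y v = fderiv ℝ f y v := fun y hy ↦ by rw [(gU y hy).fderiv_eq]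
  constructor
  · exact dgint.integrableOn.congr_fun h1 hU.measurableSet
  · rw [← MeasureTheory.setIntegral_congr_fun hU.measurableSet h1,
      MeasureTheory.setIntegral_eq_integral_of_forall_compl_eq_zero]
    -- Integration by parts against the constant function `1`.
    · have := integral_mul_fderiv_eq_neg_fderiv_mul_of_integrable (μ := MeasureTheory.volume)
        (f := fun _ : RSpace n ↦ (1 : ℝ)) (g := g) (v := v) (by simp) (by simpa using dgint)
        (by simpa using gsmooth.continuous.integrable_of_hasCompactSupport gcomp)
        (fun _ _ ↦ differentiableAt_const _)
        (fun y _ ↦ gsmooth.differentiable one_ne_zero y)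
      simpa using this
    · intro y hy
      rw [(gK y fun h ↦ hy (hKU h)).fderiv_eq]
      simp

/-- Averaging an alternating sum over the powers of an even permutation. -/
theorem three_mul_sum_perm {n : ℕ} (c : Equiv.Perm (Fin n)) (hc : Equiv.Perm.sign c = 1)
    (F : Equiv.Perm (Fin n) → ℝ) :
    3 * ∑ σ, (Equiv.Perm.sign σ : ℝ) * F σ =
      ∑ σ, (Equiv.Perm.sign σ : ℝ) * (F σ + F (σ * c) + F (σ * c * c)) := by
  have h : ∀ G : Equiv.Perm (Fin n) → ℝ, ∑ σ, (Equiv.Perm.sign σ : ℝ) * G (σ * c) =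
      ∑ σ, (Equiv.Perm.sign σ : ℝ) * G σ := by
    intro G
    rw [← Equiv.sum_comp (Equiv.mulRight c) fun σ ↦ (Equiv.Perm.sign σ : ℝ) * G σ]
    simp [Equiv.Perm.sign_mul, hc]
  simp only [mul_add, Finset.sum_add_distrib]
  rw [h (fun σ ↦ F (σ * c)), h F]
  ring

/-- The cyclic form of the exterior derivative matches averaging over the powers of a 3-cycle in
`three_mul_sum_perm`. -/
theorem extDeriv_two_form_apply {E : Type*} [NormedAddCommGroup E] [NormedSpace ℝ E]
    (b : E → E [⋀^Fin 2]→L[ℝ] ℝ) (y x₀ x₁ x₂ : E) :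
    extDeriv b y ![x₀, x₁, x₂] = fderiv ℝ b y x₀ ![x₁, x₂] + fderiv ℝ b y x₁ ![x₂, x₀] +
      fderiv ℝ b y x₂ ![x₀, x₁] := by
  rw [extDeriv, ContinuousAlternatingMap.alternatizeUncurryFin_apply, Fin.sum_univ_three,
    (fderiv ℝ b y x₁).apply_vecCons_swap]
  have h0 : Fin.removeNth 0 ![x₀, x₁, x₂] = ![x₁, x₂] := by ext i : 1; fin_cases i <;> rfl
  have h1 : Fin.removeNth 1 ![x₀, x₁, x₂] = ![x₀, x₂] := by ext i : 1; fin_cases i <;> rfl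
  have h2 : Fin.removeNth 2 ![x₀, x₁, x₂] = ![x₀, x₁] := by ext i : 1; fin_cases i <;> rfl
  rw [h0, h1, h2]
  simp

/-- Leibniz' rule for `d (g β ∧ a ∧ a)` with `a` a closed `2`-form. -/
theorem sum_perm_fderiv_mul {a b : RSpace 7 → (RSpace 7) [⋀^Fin 2]→L[ℝ] ℝ} {g : RSpace 7 → ℝ}
    {y : RSpace 7} (ha : DifferentiableAt ℝ a y) (hb : DifferentiableAt ℝ b y)
    (hg : DifferentiableAt ℝ g y) (hda : extDeriv a y = 0) :
    ∑ σ : Equiv.Perm (Fin 7), (Equiv.Perm.sign σ : ℝ) *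
      fderiv ℝ (fun z ↦ g z * (b z ![stdVec (σ 1), stdVec (σ 2)] *
        (a z ![stdVec (σ 3), stdVec (σ 4)] * a z ![stdVec (σ 5), stdVec (σ 6)]))) y
        (stdVec (σ 0)) =
      altCoeff (tensor1222 (fderiv ℝ g y) (b y) (a y) (a y)) +
        g y / 3 * altCoeff (tensor322 (extDeriv b y) (a y) (a y)) := by
  have hev : ∀ {c : RSpace 7 → (RSpace 7) [⋀^Fin 2]→L[ℝ] ℝ}, DifferentiableAt ℝ c y → ∀ v w,
      DifferentiableAt ℝ (fun z ↦ c z v) y ∧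
        fderiv ℝ (fun z ↦ c z v) y w = fderiv ℝ c y w v := fun hc v w ↦
    ⟨hc.continuousAlternatingMap_apply_const v,
      fderiv_continuousAlternatingMap_apply_const_apply hc v w⟩
  have h1 : ∀ i j k l m n p : Fin 7,
      fderiv ℝ (fun z ↦ g z * (b z ![stdVec i, stdVec j] *
        (a z ![stdVec k, stdVec l] * a z ![stdVec m, stdVec n]))) y (stdVec p) =
      fderiv ℝ g y (stdVec p) * (b y ![stdVec i, stdVec j] *
        (a y ![stdVec k, stdVec l] * a y ![stdVec m, stdVec n])) +
      g y * (fderiv ℝ b y (stdVec p) ![stdVec i, stdVec j] *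
        (a y ![stdVec k, stdVec l] * a y ![stdVec m, stdVec n])) +
      g y * (b y ![stdVec i, stdVec j] *
        (fderiv ℝ a y (stdVec p) ![stdVec k, stdVec l] * a y ![stdVec m, stdVec n])) +
      g y * (b y ![stdVec i, stdVec j] *
        (a y ![stdVec k, stdVec l] * fderiv ℝ a y (stdVec p) ![stdVec m, stdVec n])) := by
    intro i j k l m n p
    have db := hev hb ![stdVec i, stdVec j] (stdVec p)
    have da := hev ha ![stdVec k, stdVec l] (stdVec p)
    have da' := hev ha ![stdVec m, stdVec n] (stdVec p)
    rw [fderiv_fun_mul hg (db.1.fun_mul (da.1.fun_mul da'.1)),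
      fderiv_fun_mul db.1 (da.1.fun_mul da'.1), fderiv_fun_mul da.1 da'.1, ← db.2, ← da.2, ← da'.2]
    simp only [add_apply, smul_apply, smul_eq_mul]
    ring
  have hA : ∀ p i j, fderiv ℝ a y (stdVec p) ![stdVec i, stdVec j] +
      fderiv ℝ a y (stdVec i) ![stdVec j, stdVec p] +
      fderiv ℝ a y (stdVec j) ![stdVec p, stdVec i] = 0 := by
    intro p i j
    rw [← extDeriv_two_form_apply, hda]
    rfl
  simp only [h1]
  simp only [mul_add, Finset.sum_add_distrib]
  -- The 3-cycles rotate the direction of differentiation through the two slots of the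
  -- differentiated factor. Averaging yields `db` in `t2`, and `da = 0` in `t3` and `t4`; this is
  -- the source of the factor `1/3`.
  have t2 := three_mul_sum_perm (Equiv.swap 0 1 * Equiv.swap 1 2) (by decide +kernel)
    fun σ : Equiv.Perm (Fin 7) ↦ g y * (fderiv ℝ b y (stdVec (σ 0)) ![stdVec (σ 1), stdVec (σ 2)] *
        (a y ![stdVec (σ 3), stdVec (σ 4)] * a y ![stdVec (σ 5), stdVec (σ 6)]))
  have t3 := three_mul_sum_perm (Equiv.swap 0 3 * Equiv.swap 3 4) (by decide +kernel)
    fun σ : Equiv.Perm (Fin 7) ↦ g y * (b y ![stdVec (σ 1), stdVec (σ 2)] *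
      (fderiv ℝ a y (stdVec (σ 0)) ![stdVec (σ 3), stdVec (σ 4)] *
        a y ![stdVec (σ 5), stdVec (σ 6)]))
  have t4 := three_mul_sum_perm (Equiv.swap 0 5 * Equiv.swap 5 6) (by decide +kernel)
    fun σ : Equiv.Perm (Fin 7) ↦ g y * (b y ![stdVec (σ 1), stdVec (σ 2)] *
      (a y ![stdVec (σ 3), stdVec (σ 4)] *
        fderiv ℝ a y (stdVec (σ 0)) ![stdVec (σ 5), stdVec (σ 6)]))
  simp only [Equiv.Perm.mul_apply, Equiv.swap_apply_def, Fin.reduceEq, if_true, if_false] at t2 t3 t4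
  have e2 : ∀ σ : Equiv.Perm (Fin 7), (Equiv.Perm.sign σ : ℝ) *
      (g y * (extDeriv b y ![stdVec (σ 0), stdVec (σ 1), stdVec (σ 2)] *
        (a y ![stdVec (σ 3), stdVec (σ 4)] * a y ![stdVec (σ 5), stdVec (σ 6)]))) =
      g y * ((Equiv.Perm.sign σ : ℝ) * (extDeriv b y ![stdVec (σ 0), stdVec (σ 1), stdVec (σ 2)] *
        (a y ![stdVec (σ 3), stdVec (σ 4)] * a y ![stdVec (σ 5), stdVec (σ 6)]))) := fun σ ↦ by ring
  have t2' := t2.trans (Finset.sum_congr rfl fun σ _ ↦ (congrArg _ (by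
    rw [extDeriv_two_form_apply]; ring)).trans (e2 σ))
  have t3' := t3.trans (Finset.sum_eq_zero fun σ _ ↦ by
    linear_combination (Equiv.Perm.sign σ : ℝ) * (g y * b y ![stdVec (σ 1), stdVec (σ 2)] *
      a y ![stdVec (σ 5), stdVec (σ 6)]) * hA (σ 0) (σ 3) (σ 4))
  have t4' := t4.trans (Finset.sum_eq_zero fun σ _ ↦ by
    linear_combination (Equiv.Perm.sign σ : ℝ) * (g y * b y ![stdVec (σ 1), stdVec (σ 2)] *
      a y ![stdVec (σ 3), stdVec (σ 4)]) * hA (σ 0) (σ 5) (σ 6))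
  rw [← Finset.mul_sum] at t2'
  simp only [altCoeff, tensor322_apply, tensor1222_apply, mul_assoc]
  linear_combination (1 / 3) * t2' + (1 / 3) * t3' + (1 / 3) * t4'

end Divergence

/-! ### The orientation determined by a G₂-form, and Stokes' theorem on an open set -/

section Orientation

/-- The coefficient of `φ ∧ i_u φ ∧ i_u φ` on the standard basis, up to a positive factor. -/
noncomputable def bryantForm (φ : (RSpace 7) [⋀^Fin 3]→L[ℝ] ℝ) (u : RSpace 7) : ℝ :=
  altCoeff (tensor322 φ (φ.curryLeft u) (φ.curryLeft u))

/-- The orientation of `ℝ⁷` determined by a `3`-form, as a sign. -/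
noncomputable def orientSign (φ : (RSpace 7) [⋀^Fin 3]→L[ℝ] ℝ) : ℝ :=
  Real.sign (bryantForm φ (stdVec 0))

/-- The forms in the orbit of `φ₀`. -/
def IsG2Form (φ : (RSpace 7) [⋀^Fin 3]→L[ℝ] ℝ) : Prop :=
  ∃ A : RSpace 7 ≃L[ℝ] RSpace 7,
    φ = phi0.compContinuousLinearMap (A : RSpace 7 →L[ℝ] RSpace 7)

theorem ContinuousLinearEquiv.det_coe_ne_zero (A : RSpace 7 ≃L[ℝ] RSpace 7) :
    (A : RSpace 7 →L[ℝ] RSpace 7).det ≠ 0 :=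
  A.toLinearEquiv.isUnit_det'.ne_zero

theorem Real.sign_mul_eq (x y : ℝ) : Real.sign (x * y) = Real.sign x * Real.sign y := by
  rcases lt_trichotomy x 0 with hx | rfl | hx <;> rcases lt_trichotomy y 0 with hy | rfl | hy <;>
    simp [Real.sign_of_neg, Real.sign_of_pos, mul_pos_of_neg_of_neg, mul_neg_of_neg_of_pos,
      mul_neg_of_pos_of_neg, *]

theorem Real.sign_mul_self_eq_abs (x : ℝ) : Real.sign x * x = |x| := by
  rcases lt_trichotomy x 0 with hx | rfl | hx
  · rw [Real.sign_of_neg hx, abs_of_neg hx, neg_one_mul]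
  · simp
  · rw [Real.sign_of_pos hx, abs_of_pos hx, one_mul]

theorem stdVec_ne_zero (i : Fin 7) : stdVec i ≠ 0 :=
  (EuclideanSpace.basisFun (Fin 7) ℝ).orthonormal.ne_zero i

/-- The value of `bryantForm` at any nonzero vector is `det A` times a positive number, so the
choice of `stdVec 0` is immaterial. -/
theorem orientSign_comp_eq (A : RSpace 7 ≃L[ℝ] RSpace 7) :
    orientSign (phi0.compContinuousLinearMap (A : RSpace 7 →L[ℝ] RSpace 7)) =
      Real.sign (A : RSpace 7 →L[ℝ] RSpace 7).det := by
  have h : 0 < 144 * ‖(A : RSpace 7 →L[ℝ] RSpace 7) (stdVec 0)‖ ^ 2 := by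
    have : ‖A (stdVec 0)‖ ≠ 0 := by
      rw [norm_ne_zero_iff, map_ne_zero_iff _ A.injective]
      exact stdVec_ne_zero 0
    have : 0 < ‖A (stdVec 0)‖ := lt_of_le_of_ne (norm_nonneg _) this.symm
    simp only [ContinuousLinearEquiv.coe_coe]
    positivity
  rw [orientSign, bryantForm, altCoeff_tensor322_of_phi0_comp, Real.sign_mul_eq,
    Real.sign_of_pos h, mul_one]

theorem IsG2Form.bryantForm_ne_zero {φ : (RSpace 7) [⋀^Fin 3]→L[ℝ] ℝ} (h : IsG2Form φ)
    {u : RSpace 7} (hu : u ≠ 0) : bryantForm φ u ≠ 0 := by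
  obtain ⟨A, rfl⟩ := h
  rw [bryantForm, altCoeff_tensor322_of_phi0_comp]
  refine mul_ne_zero A.det_coe_ne_zero (mul_ne_zero (by norm_num) (pow_ne_zero _ ?_))
  rw [norm_ne_zero_iff]
  exact (map_ne_zero_iff _ A.injective).2 hu

theorem IsG2Form.orientSign_mul_bryantForm_nonneg {φ : (RSpace 7) [⋀^Fin 3]→L[ℝ] ℝ}
    (h : IsG2Form φ) (u : RSpace 7) : 0 ≤ orientSign φ * bryantForm φ u := by
  obtain ⟨A, rfl⟩ := h
  rw [bryantForm, altCoeff_tensor322_of_phi0_comp, orientSign_comp_eq, ← mul_assoc,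
    Real.sign_mul_self_eq_abs]
  positivity

theorem IsG2Form.orientSign_ne_zero {φ : (RSpace 7) [⋀^Fin 3]→L[ℝ] ℝ} (h : IsG2Form φ) :
    orientSign φ ≠ 0 := by
  obtain ⟨A, rfl⟩ := h
  rw [orientSign_comp_eq, Ne, Real.sign_eq_zero_iff]
  exact A.det_coe_ne_zero

/-- This sign compensates that of the Jacobian determinant under a chart change, so integration
needs no orientation of the manifold. -/
theorem IsG2Form.orientSign_comp {φ : (RSpace 7) [⋀^Fin 3]→L[ℝ] ℝ} (h : IsG2Form φ)
    (L : RSpace 7 ≃L[ℝ] RSpace 7) :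
    orientSign (φ.compContinuousLinearMap (L : RSpace 7 →L[ℝ] RSpace 7)) =
      Real.sign (L : RSpace 7 →L[ℝ] RSpace 7).det * orientSign φ := by
  obtain ⟨A, rfl⟩ := h
  have h1 := orientSign_comp_eq (L.trans A)
  have h2 : ((L.trans A : RSpace 7 ≃L[ℝ] RSpace 7) : RSpace 7 →L[ℝ] RSpace 7).det =
      (L : RSpace 7 →L[ℝ] RSpace 7).det * (A : RSpace 7 →L[ℝ] RSpace 7).det := by
    rw [mul_comm]
    exact LinearMap.det_comp _ _
  rw [orientSign_comp_eq, ← Real.sign_mul_eq, ← h2, ← h1]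
  rfl

/-- A continuous nonvanishing function has locally constant sign. -/
theorem contDiffOn_sign_comp {n : ℕ} {U : Set (RSpace n)} (hU : IsOpen U) {q : RSpace n → ℝ}
    (hq : ContinuousOn q U) (h0 : ∀ y ∈ U, q y ≠ 0) (r : ℕ∞ω) :
    ContDiffOn ℝ r (fun y ↦ Real.sign (q y)) U := by
  intro y hy
  have hc := hq.continuousAt (hU.mem_nhds hy)
  refine ContDiffAt.contDiffWithinAt ?_
  rcases (h0 y hy).lt_or_gt with h | h
  · refine (contDiffAt_const (c := (-1 : ℝ))).congr_of_eventuallyEq ?_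
    filter_upwards [hc.eventually_lt_const h] with z hz using Real.sign_of_neg hz
  · refine (contDiffAt_const (c := (1 : ℝ))).congr_of_eventuallyEq ?_
    filter_upwards [hc.eventually_const_lt h] with z hz using Real.sign_of_pos hz

theorem fderiv_sign_comp {n : ℕ} {q : RSpace n → ℝ} {y : RSpace n} (hq : ContinuousAt q y)
    (h0 : q y ≠ 0) : fderiv ℝ (fun y ↦ Real.sign (q y)) y = 0 := by
  have h : (fun z ↦ Real.sign (q z)) =ᶠ[nhds y] fun _ ↦ Real.sign (q y) := by
    rcases h0.lt_or_gt with h | h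
    · filter_upwards [hq.eventually_lt_const h] with z hz
      rw [Real.sign_of_neg hz, Real.sign_of_neg h]
    · filter_upwards [hq.eventually_const_lt h] with z hz
      rw [Real.sign_of_pos hz, Real.sign_of_pos h]
  rw [h.fderiv_eq]
  simp

theorem contDiffOn_apply_const {n k : ℕ} {r : ℕ∞ω} {U : Set (RSpace n)}
    {c : RSpace n → (RSpace n) [⋀^Fin k]→L[ℝ] ℝ} (hc : ContDiffOn ℝ r c U)
    (v : Fin k → RSpace n) : ContDiffOn ℝ r (fun y ↦ c y v) U :=
  ContDiff.comp_contDiffOn (g := ContinuousAlternatingMap.apply ℝ (RSpace n) ℝ v)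
    (ContinuousLinearMap.contDiff _) hc

theorem contDiffOn_altCoeff_tensor322 {r : ℕ∞ω} {U : Set (RSpace 7)}
    {c : RSpace 7 → (RSpace 7) [⋀^Fin 3]→L[ℝ] ℝ} {a b : RSpace 7 → (RSpace 7) [⋀^Fin 2]→L[ℝ] ℝ}
    (hc : ContDiffOn ℝ r c U) (ha : ContDiffOn ℝ r a U) (hb : ContDiffOn ℝ r b U) :
    ContDiffOn ℝ r (fun y ↦ altCoeff (tensor322 (c y) (a y) (b y))) U := by
  simp only [altCoeff, tensor322_apply]
  exact ContDiffOn.sum fun σ _ ↦ contDiffOn_const.mul ((contDiffOn_apply_const hc _).mul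
    ((contDiffOn_apply_const ha _).mul (contDiffOn_apply_const hb _)))

theorem continuousOn_altCoeff_tensor1222 {U : Set (RSpace 7)} {θ : RSpace 7 → RSpace 7 →L[ℝ] ℝ}
    {b a a' : RSpace 7 → (RSpace 7) [⋀^Fin 2]→L[ℝ] ℝ} (hθ : ContinuousOn θ U)
    (hb : ContDiffOn ℝ 0 b U) (ha : ContDiffOn ℝ 0 a U) (ha' : ContDiffOn ℝ 0 a' U) :
    ContinuousOn (fun y ↦ altCoeff (tensor1222 (θ y) (b y) (a y) (a' y))) U := by
  simp only [altCoeff, tensor1222_apply]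
  exact continuousOn_finsetSum _ fun σ _ ↦ continuousOn_const.mul
    (((hθ.clm_apply continuousOn_const).mul (contDiffOn_apply_const hb _).continuousOn).mul
    ((contDiffOn_apply_const ha _).continuousOn.mul (contDiffOn_apply_const ha' _).continuousOn))

theorem altCoeff_tensor1222_sum {ι : Type*} (s : Finset ι) (θ : ι → RSpace 7 →L[ℝ] ℝ)
    (b a a' : (RSpace 7) [⋀^Fin 2]→L[ℝ] ℝ) :
    altCoeff (tensor1222 (∑ i ∈ s, θ i) b a a') =
      ∑ i ∈ s, altCoeff (tensor1222 (θ i) b a a') := by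
  simp only [altCoeff, tensor1222_apply, sum_apply]
  rw [Finset.sum_comm]
  simp only [Finset.sum_mul, Finset.mul_sum]

theorem altCoeff_tensor1222_zero (b a a' : (RSpace 7) [⋀^Fin 2]→L[ℝ] ℝ) :
    altCoeff (tensor1222 0 b a a') = 0 := by
  simp [altCoeff, tensor1222_apply]

/-- Stokes' theorem for `d (s r b ∧ a ∧ a)` with `s` locally constant, `r` compactly supported and
`a` closed. -/
theorem integral_altCoeff_eq_zero {U K : Set (RSpace 7)} (hU : IsOpen U) (hK : IsCompact K)
    (hKU : K ⊆ U) {s r : RSpace 7 → ℝ} {a b : RSpace 7 → (RSpace 7) [⋀^Fin 2]→L[ℝ] ℝ}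
    (ss : ContDiffOn ℝ ∞ s U) (hs : ∀ y ∈ U, fderiv ℝ s y = 0) (rs : ContDiffOn ℝ ∞ r U)
    (hr : ∀ y ∈ U \ K, r y = 0) (ha : ContDiffOn ℝ ∞ a U) (hb : ContDiffOn ℝ ∞ b U)
    (hda : ∀ y ∈ U, extDeriv a y = 0) :
    ∫ y in U, s y * (altCoeff (tensor1222 (fderiv ℝ r y) (b y) (a y) (a y)) +
      r y / 3 * altCoeff (tensor322 (extDeriv b y) (a y) (a y))) = 0 := by
  have hG : ∀ σ : Equiv.Perm (Fin 7), ContDiffOn ℝ 1 (fun z ↦ r z *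
      (b z ![stdVec (σ 1), stdVec (σ 2)] * (a z ![stdVec (σ 3), stdVec (σ 4)] *
        a z ![stdVec (σ 5), stdVec (σ 6)]))) U := fun σ ↦
    ContDiffOn.of_le (rs.mul ((contDiffOn_apply_const hb _).mul
      ((contDiffOn_apply_const ha _).mul (contDiffOn_apply_const ha _)))) (by simp)
  -- Every permutation contributes a directional derivative of a compactly supported function, so
  -- its integral vanishes separately.
  have hzero := fun σ ↦ integral_fderiv_eq_zero_of_eq_zero_off_compact hU hK hKU
    ((ss.of_le (by simp)).mul (hG σ))
    (fun y hy ↦ by rw [hr y hy, zero_mul, mul_zero]) (stdVec (σ 0))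
  have hpt : ∀ y ∈ U, ∑ σ : Equiv.Perm (Fin 7), (Equiv.Perm.sign σ : ℝ) *
      fderiv ℝ (fun z ↦ s z * (r z * (b z ![stdVec (σ 1), stdVec (σ 2)] *
        (a z ![stdVec (σ 3), stdVec (σ 4)] * a z ![stdVec (σ 5), stdVec (σ 6)])))) y
        (stdVec (σ 0)) =
      s y * (altCoeff (tensor1222 (fderiv ℝ r y) (b y) (a y) (a y)) +
      r y / 3 * altCoeff (tensor322 (extDeriv b y) (a y) (a y))) := by
    intro y hy
    have hn := hU.mem_nhds hy
    rw [← sum_perm_fderiv_mul ((ha.contDiffAt hn).differentiableAt (by simp))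
      ((hb.contDiffAt hn).differentiableAt (by simp))
      ((rs.contDiffAt hn).differentiableAt (by simp)) (hda y hy), Finset.mul_sum]
    refine Finset.sum_congr rfl fun σ _ ↦ ?_
    rw [fderiv_fun_mul ((ss.contDiffAt hn).differentiableAt (by simp))
      (((hG σ).contDiffAt hn).differentiableAt one_ne_zero), hs y hy, smul_zero, add_zero,
      smul_apply, smul_eq_mul]
    ring
  rw [← MeasureTheory.setIntegral_congr_fun hU.measurableSet hpt,
    MeasureTheory.integral_finsetSum _ fun σ _ ↦ (hzero σ).1.const_mul _]
  refine Finset.sum_eq_zero fun σ _ ↦ ?_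
  rw [MeasureTheory.integral_const_mul, (hzero σ).2, mul_zero]

end Orientation

/-! ### Densities on the manifold and their independence of the chart -/

section Stokes

variable {M : Type*} [TopologicalSpace M] [ChartedSpace (RSpace 7) M] [IsManifold (𝓡 7) ∞ M]

omit [IsManifold (𝓡 7) ∞ M] in
theorem isOpen_target7 (x : M) : IsOpen (extChartAt (𝓡 7) x).target := isOpen_extChartAt_target x

theorem exists_equiv_fderiv_chartChange {x₀ x₁ : M} {y : RSpace 7} (hy : y ∈ chartOverlap x₀ x₁) :
    ∃ L : RSpace 7 ≃L[ℝ] RSpace 7,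
      (L : RSpace 7 →L[ℝ] RSpace 7) = fderiv ℝ (chartChange x₀ x₁) y := by
  have h1 : ∀ {x₀ x₁ : M} {y : RSpace 7}, y ∈ chartOverlap x₀ x₁ →
      (fderiv ℝ (chartChange x₁ x₀) (chartChange x₀ x₁ y)).comp (fderiv ℝ (chartChange x₀ x₁) y) =
        .id ℝ (RSpace 7) := by
    intro x₀ x₁ y hy
    rw [← fderiv_comp y
      ((contDiffAt_chartChange (chartChange_mem hy)).differentiableAt (by simp))
      ((contDiffAt_chartChange hy).differentiableAt (by simp)), ← fderiv_id (x := y)]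
    refine Filter.EventuallyEq.fderiv_eq ?_
    filter_upwards [(isOpen_chartOverlap x₀ x₁).mem_nhds hy] with z hz
    exact chartChange_chartChange hz
  have h2 := h1 (chartChange_mem hy)
  rw [chartChange_chartChange hy] at h2
  exact ⟨ContinuousLinearEquiv.equivOfInverse _ _
    (fun v ↦ DFunLike.congr_fun (h1 hy) v) (fun v ↦ DFunLike.congr_fun h2 v), rfl⟩

theorem IsG2Structure.isG2Form_inChart {φ : DiffForm 7 3 M} (hφ : IsG2Structure φ) {x : M}
    {y : RSpace 7} (hy : y ∈ (extChartAt (𝓡 7) x).target) : IsG2Form (φ.inChart x y) := by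
  obtain ⟨A, hA⟩ := isInvertible_mfderiv_extChartAt_symm' hy
  obtain ⟨u, hu⟩ := hφ.2 ((extChartAt (𝓡 7) x).symm y)
  refine ⟨A.trans u, ?_⟩
  rw [DiffForm.inChart, ← hA, hu]
  rfl

theorem contDiffOn_comp_symm {ρ : M → ℝ} (hρ : ContMDiff (𝓡 7) 𝓘(ℝ, ℝ) ∞ ρ) (x : M) :
    ContDiffOn ℝ ∞ (fun y ↦ ρ ((extChartAt (𝓡 7) x).symm y)) (extChartAt (𝓡 7) x).target :=
  contMDiffOn_iff_contDiffOn.1 (hρ.comp_contMDiffOn (contMDiffOn_extChartAt_symm x))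

/-- The expression in the chart at `x` of the density `χ dρ ∧ β ∧ a ∧ a`, oriented by `φ`. -/
noncomputable def chartDensity (φ : DiffForm 7 3 M) (β a : DiffForm 7 2 M) (χ ρ : M → ℝ) (x : M)
    (y : RSpace 7) : ℝ :=
  orientSign (φ.inChart x y) * (χ ((extChartAt (𝓡 7) x).symm y) * altCoeff (tensor1222
    (fderiv ℝ (fun z ↦ ρ ((extChartAt (𝓡 7) x).symm z)) y) (β.inChart x y) (a.inChart x y)
    (a.inChart x y)))

variable {φ : DiffForm 7 3 M} {β a : DiffForm 7 2 M} {χ ρ : M → ℝ}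

/-- The 7-form contributes the Jacobian determinant and `orientSign` its sign; together they give
the absolute value required by the change of variables formula. -/
theorem chartDensity_chartChange (hφ : IsG2Structure φ) (hρ : ContMDiff (𝓡 7) 𝓘(ℝ, ℝ) ∞ ρ)
    {x₀ x₁ : M} {y : RSpace 7} (hy : y ∈ chartOverlap x₀ x₁) :
    chartDensity φ β a χ ρ x₀ y = |(fderiv ℝ (chartChange x₀ x₁) y).det| *
      chartDensity φ β a χ ρ x₁ (chartChange x₀ x₁ y) := by
  obtain ⟨L, hL⟩ := exists_equiv_fderiv_chartChange hy
  have h1 : fderiv ℝ (fun z ↦ ρ ((extChartAt (𝓡 7) x₀).symm z)) y =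
      (fderiv ℝ (fun z ↦ ρ ((extChartAt (𝓡 7) x₁).symm z)) (chartChange x₀ x₁ y)).comp
        (fderiv ℝ (chartChange x₀ x₁) y) := by
    rw [← fderiv_comp y (((contDiffOn_comp_symm hρ x₁).contDiffAt
      ((isOpen_target7 x₁).mem_nhds (chartChange_mem hy).1)).differentiableAt (by simp))
      ((contDiffAt_chartChange hy).differentiableAt (by simp))]
    refine Filter.EventuallyEq.fderiv_eq ?_
    filter_upwards [(isOpen_chartOverlap x₀ x₁).mem_nhds hy] with z hz
    simp only [Function.comp_apply]
    rw [symm_chartChange hz]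
  simp only [chartDensity]
  rw [h1, φ.inChart_eq_comp hy, β.inChart_eq_comp hy, a.inChart_eq_comp hy, symm_chartChange hy,
    altCoeff_tensor1222_comp, ← hL,
    (hφ.isG2Form_inChart (chartChange_mem hy).1).orientSign_comp L, ← Real.sign_mul_self_eq_abs]
  ring

omit [IsManifold (𝓡 7) ∞ M] in
theorem fderiv_eq_zero_of_notMem_tsupport {x : M} {y : RSpace 7}
    (hy : y ∈ (extChartAt (𝓡 7) x).target) (h : (extChartAt (𝓡 7) x).symm y ∉ tsupport ρ) :
    fderiv ℝ (fun z ↦ ρ ((extChartAt (𝓡 7) x).symm z)) y = 0 := by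
  have h1 : (fun z ↦ ρ ((extChartAt (𝓡 7) x).symm z)) =ᶠ[nhds y] fun _ ↦ 0 := by
    have h2 := (continuousOn_extChartAt_symm x).continuousAt ((isOpen_target7 x).mem_nhds hy)
    filter_upwards [h2.eventually_mem ((isClosed_tsupport ρ).isOpen_compl.mem_nhds h)] with z hz
    exact image_eq_zero_of_notMem_tsupport hz
  rw [h1.fderiv_eq]
  simp

omit [IsManifold (𝓡 7) ∞ M] in
theorem chartDensity_eq_zero_of_notMem_left {x : M} {y : RSpace 7}
    (h : (extChartAt (𝓡 7) x).symm y ∉ tsupport χ) : chartDensity φ β a χ ρ x y = 0 := by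
  rw [chartDensity, image_eq_zero_of_notMem_tsupport h]
  simp

omit [IsManifold (𝓡 7) ∞ M] in
theorem chartDensity_eq_zero_of_notMem_right {x : M} {y : RSpace 7}
    (hy : y ∈ (extChartAt (𝓡 7) x).target) (h : (extChartAt (𝓡 7) x).symm y ∉ tsupport ρ) :
    chartDensity φ β a χ ρ x y = 0 := by
  rw [chartDensity, fderiv_eq_zero_of_notMem_tsupport hy h, altCoeff_tensor1222_zero]
  simp

/-- The integral of a density supported in the overlap of two charts can be computed in either. -/
theorem integral_chartDensity_eq (hφ : IsG2Structure φ) (hρ : ContMDiff (𝓡 7) 𝓘(ℝ, ℝ) ∞ ρ)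
    {x₀ x₁ : M} (h₀ : tsupport ρ ⊆ (extChartAt (𝓡 7) x₀).source)
    (h₁ : tsupport χ ⊆ (extChartAt (𝓡 7) x₁).source) :
    ∫ y in (extChartAt (𝓡 7) x₀).target, chartDensity φ β a χ ρ x₀ y =
      ∫ y in (extChartAt (𝓡 7) x₁).target, chartDensity φ β a χ ρ x₁ y := by
  -- Outside the overlap the density vanishes for different reasons: in the chart at `x₀` because of
  -- `χ`, in the chart at `x₁` because of `dρ`.
  have e₀ : ∫ y in (extChartAt (𝓡 7) x₀).target, chartDensity φ β a χ ρ x₀ y =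
      ∫ y in chartOverlap x₀ x₁, chartDensity φ β a χ ρ x₀ y := by
    refine MeasureTheory.setIntegral_eq_of_subset_of_forall_sdiff_eq_zero
      (isOpen_target7 x₀).measurableSet Set.inter_subset_left fun y hy ↦ ?_
    exact chartDensity_eq_zero_of_notMem_left fun h ↦ hy.2 ⟨hy.1, h₁ h⟩
  have e₁ : ∫ y in (extChartAt (𝓡 7) x₁).target, chartDensity φ β a χ ρ x₁ y =
      ∫ y in chartOverlap x₁ x₀, chartDensity φ β a χ ρ x₁ y := by
    refine MeasureTheory.setIntegral_eq_of_subset_of_forall_sdiff_eq_zero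
      (isOpen_target7 x₁).measurableSet Set.inter_subset_left fun y hy ↦ ?_
    exact chartDensity_eq_zero_of_notMem_right hy.1 fun h ↦ hy.2 ⟨hy.1, h₀ h⟩
  have himg : chartChange x₀ x₁ '' chartOverlap x₀ x₁ = chartOverlap (n := 7) x₁ x₀ := by
    refine Set.Subset.antisymm (Set.image_subset_iff.2 fun y hy ↦ chartChange_mem hy) fun y hy ↦ ?_
    exact ⟨chartChange x₁ x₀ y, chartChange_mem hy, chartChange_chartChange hy⟩
  have hinj : Set.InjOn (chartChange x₀ x₁) (chartOverlap (n := 7) x₀ x₁) :=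
    Set.LeftInvOn.injOn (f₁' := chartChange x₁ x₀) fun y hy ↦ chartChange_chartChange hy
  have hmeas := (isOpen_chartOverlap (n := 7) x₀ x₁).measurableSet
  rw [e₀, e₁, ← himg, MeasureTheory.integral_image_eq_integral_abs_det_fderiv_smul
    MeasureTheory.volume hmeas (fun y hy ↦ ((contDiffAt_chartChange hy).differentiableAt
      (by simp)).hasFDerivAt.hasFDerivWithinAt) hinj]
  exact MeasureTheory.setIntegral_congr_fun hmeas fun y hy ↦ chartDensity_chartChange hφ hρ hy

omit [IsManifold (𝓡 7) ∞ M] in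
theorem continuousOn_bryantForm (hφ : IsG2Structure φ) (x : M) (u : RSpace 7) :
    ContinuousOn (fun y ↦ bryantForm (φ.inChart x y) u) (extChartAt (𝓡 7) x).target := by
  have h1 : ContDiffOn ℝ ∞ (fun y ↦ (φ.inChart x y).curryLeft u)
      (extChartAt (𝓡 7) x).target :=
    ContDiffOn.clm_apply (f := fun y ↦ ContinuousAlternatingMap.curryLeftLI (𝕜 := ℝ)
      (E := RSpace 7) (F := ℝ) (n := 2) (φ.inChart x y))
      ((LinearIsometry.contDiff _).comp_contDiffOn (hφ.1 x)) contDiffOn_const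
  exact (contDiffOn_altCoeff_tensor322 (hφ.1 x) h1 h1).continuousOn

theorem contDiffOn_orientSign (hφ : IsG2Structure φ) (x : M) :
    ContDiffOn ℝ ∞ (fun y ↦ orientSign (φ.inChart x y)) (extChartAt (𝓡 7) x).target :=
  contDiffOn_sign_comp (isOpen_target7 x) (continuousOn_bryantForm hφ x _)
    (fun _ hy ↦ (hφ.isG2Form_inChart hy).bryantForm_ne_zero (stdVec_ne_zero 0)) _

theorem fderiv_orientSign (hφ : IsG2Structure φ) {x : M} {y : RSpace 7}
    (hy : y ∈ (extChartAt (𝓡 7) x).target) :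
    fderiv ℝ (fun z ↦ orientSign (φ.inChart x z)) y = 0 :=
  fderiv_sign_comp ((continuousOn_bryantForm hφ x _).continuousAt
    ((isOpen_target7 x).mem_nhds hy))
    ((hφ.isG2Form_inChart hy).bryantForm_ne_zero (stdVec_ne_zero 0))

theorem continuousOn_chartDensity (hφ : IsG2Structure φ) (hβ : β.IsSmooth) (ha : a.IsSmooth)
    (hχ : ContMDiff (𝓡 7) 𝓘(ℝ, ℝ) ∞ χ) (hρ : ContMDiff (𝓡 7) 𝓘(ℝ, ℝ) ∞ ρ) (x : M) :
    ContinuousOn (chartDensity φ β a χ ρ x) (extChartAt (𝓡 7) x).target :=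
  (contDiffOn_orientSign hφ x).continuousOn.mul
    ((contDiffOn_comp_symm hχ x).continuousOn.mul (continuousOn_altCoeff_tensor1222
      ((contDiffOn_comp_symm hρ x).continuousOn_fderiv_of_isOpen (isOpen_target7 x) (by simp))
      ((hβ x).of_le (by simp)) ((ha x).of_le (by simp)) ((ha x).of_le (by simp))))

end Stokes

/-! ### Global Stokes' theorem and vanishing of the vector field -/

section Rigidity

variable {M : Type*} [TopologicalSpace M] [CompactSpace M] [ChartedSpace (RSpace 7) M]

/-- The image in the chart at `x` of the support of a function. -/
def chartSupport (ρ : M → ℝ) (x : M) : Set (RSpace 7) := extChartAt (𝓡 7) x '' tsupport ρ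

theorem isCompact_chartSupport {ρ : M → ℝ} {x : M}
    (h : tsupport ρ ⊆ (extChartAt (𝓡 7) x).source) : IsCompact (chartSupport ρ x) :=
  (isClosed_tsupport ρ).isCompact.image_of_continuousOn ((continuousOn_extChartAt x).mono h)

omit [CompactSpace M] in
theorem chartSupport_subset {ρ : M → ℝ} {x : M}
    (h : tsupport ρ ⊆ (extChartAt (𝓡 7) x).source) :
    chartSupport ρ x ⊆ (extChartAt (𝓡 7) x).target :=
  Set.image_subset_iff.2 fun _ hp ↦ (extChartAt (𝓡 7) x).map_source (h hp)

omit [CompactSpace M] in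
theorem symm_notMem_tsupport {ρ : M → ℝ} {x : M} {y : RSpace 7}
    (hy : y ∈ (extChartAt (𝓡 7) x).target \ chartSupport ρ x) :
    (extChartAt (𝓡 7) x).symm y ∉ tsupport ρ :=
  fun h ↦ hy.2 ⟨_, h, (extChartAt (𝓡 7) x).right_inv hy.1⟩

variable [IsManifold (𝓡 7) ∞ M]
variable {φ : DiffForm 7 3 M} {β a : DiffForm 7 2 M}

/-- Stokes' theorem in one chart, for `d (ρ β ∧ a ∧ a)` with `a` closed and `ρ` supported in the
domain of the chart. -/
theorem integral_chartDensity_add (hφ : IsG2Structure φ) (hβ : β.IsSmooth) (hφβ : φ = β.d)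
    (ha : a.IsSmooth) (hda : a.d = 0) {ρ : M → ℝ} (hρ : ContMDiff (𝓡 7) 𝓘(ℝ, ℝ) ∞ ρ) {x : M}
    (hsupp : tsupport ρ ⊆ (extChartAt (𝓡 7) x).source) :
    MeasureTheory.IntegrableOn (fun y ↦ orientSign (φ.inChart x y) *
      (ρ ((extChartAt (𝓡 7) x).symm y) * altCoeff (tensor322 (φ.inChart x y) (a.inChart x y)
        (a.inChart x y)))) (extChartAt (𝓡 7) x).target ∧
    3 * (∫ y in (extChartAt (𝓡 7) x).target, chartDensity φ β a (fun _ ↦ 1) ρ x y) +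
      ∫ y in (extChartAt (𝓡 7) x).target, orientSign (φ.inChart x y) *
        (ρ ((extChartAt (𝓡 7) x).symm y) * altCoeff (tensor322 (φ.inChart x y) (a.inChart x y)
          (a.inChart x y))) = 0 := by
  have hU := isOpen_target7 x
  have hK := isCompact_chartSupport hsupp
  have hKU := chartSupport_subset hsupp
  have hr0 : ∀ y ∈ (extChartAt (𝓡 7) x).target \ chartSupport ρ x,
      ρ ((extChartAt (𝓡 7) x).symm y) = 0 := fun y hy ↦
    image_eq_zero_of_notMem_tsupport (symm_notMem_tsupport hy)
  have int1 : MeasureTheory.IntegrableOn (fun y ↦ orientSign (φ.inChart x y) *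
      (ρ ((extChartAt (𝓡 7) x).symm y) * altCoeff (tensor322 (φ.inChart x y) (a.inChart x y)
        (a.inChart x y)))) (extChartAt (𝓡 7) x).target :=
    integrableOn_of_eq_zero_off_compact hU hK hKU
      ((contDiffOn_orientSign hφ x).mul ((contDiffOn_comp_symm hρ x).mul
        (contDiffOn_altCoeff_tensor322 (hφ.1 x) (ha x) (ha x)))).continuousOn
      fun y hy ↦ by rw [hr0 y hy, zero_mul, mul_zero]
  have int2 : MeasureTheory.IntegrableOn (chartDensity φ β a (fun _ ↦ 1) ρ x)
      (extChartAt (𝓡 7) x).target :=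
    integrableOn_of_eq_zero_off_compact hU hK hKU
      (continuousOn_chartDensity hφ hβ ha contMDiff_const hρ x) fun y hy ↦
      chartDensity_eq_zero_of_notMem_right hy.1 (symm_notMem_tsupport hy)
  refine ⟨int1, ?_⟩
  have h := integral_altCoeff_eq_zero hU hK hKU (contDiffOn_orientSign hφ x)
    (fun y hy ↦ fderiv_orientSign hφ hy) (contDiffOn_comp_symm hρ x) hr0 (ha x) (hβ x)
    fun y hy ↦ by
      rw [← DiffForm.d_inChart ha hy, hda]
      rfl
  have hpt : ∀ y ∈ (extChartAt (𝓡 7) x).target, orientSign (φ.inChart x y) *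
      (altCoeff (tensor1222 (fderiv ℝ (fun z ↦ ρ ((extChartAt (𝓡 7) x).symm z)) y)
        (β.inChart x y) (a.inChart x y) (a.inChart x y)) + ρ ((extChartAt (𝓡 7) x).symm y) / 3 *
        altCoeff (tensor322 (extDeriv (β.inChart x) y) (a.inChart x y) (a.inChart x y))) =
      chartDensity φ β a (fun _ ↦ 1) ρ x y + 1 / 3 * (orientSign (φ.inChart x y) *
      (ρ ((extChartAt (𝓡 7) x).symm y) * altCoeff (tensor322 (φ.inChart x y) (a.inChart x y)
        (a.inChart x y)))) := by
    intro y hy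
    rw [← DiffForm.d_inChart hβ hy, ← hφβ, chartDensity]
    ring
  rw [MeasureTheory.setIntegral_congr_fun hU.measurableSet hpt,
    MeasureTheory.integral_add int2 (int1.const_mul _), MeasureTheory.integral_const_mul] at h
  linarith

/-- Formally `∑ dρ_i = d1 = 0`, but each integral lives in its own chart. Inserting `1 = ∑ ρ_j`
localizes the term `(i, j)` to the overlap of two charts; it is moved to chart `j`, where the sum
over `i` is taken first. -/
theorem sum_integral_chartDensity_eq_zero (hφ : IsG2Structure φ) (hβ : β.IsSmooth)
    (ha : a.IsSmooth) (I : Finset M) (f : M → M → ℝ)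
    (hf : ∀ i, ContMDiff (𝓡 7) 𝓘(ℝ, ℝ) ∞ (f i))
    (hsupp : ∀ i, tsupport (f i) ⊆ (extChartAt (𝓡 7) i).source)
    (hsum : ∀ p, ∑ i ∈ I, f i p = 1) :
    ∑ i ∈ I, ∫ y in (extChartAt (𝓡 7) i).target, chartDensity φ β a (fun _ ↦ 1) (f i) i y = 0 := by
  have int1 : ∀ i j, MeasureTheory.IntegrableOn (chartDensity φ β a (f j) (f i) i)
      (extChartAt (𝓡 7) i).target := fun i j ↦
    integrableOn_of_eq_zero_off_compact (isOpen_target7 i) (isCompact_chartSupport (hsupp i))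
      (chartSupport_subset (hsupp i)) (continuousOn_chartDensity hφ hβ ha (hf j) (hf i) i)
      fun y hy ↦ chartDensity_eq_zero_of_notMem_right hy.1 (symm_notMem_tsupport hy)
  have int2 : ∀ i j, MeasureTheory.IntegrableOn (chartDensity φ β a (f j) (f i) j)
      (extChartAt (𝓡 7) j).target := fun i j ↦
    integrableOn_of_eq_zero_off_compact (isOpen_target7 j) (isCompact_chartSupport (hsupp j))
      (chartSupport_subset (hsupp j)) (continuousOn_chartDensity hφ hβ ha (hf j) (hf i) j)
      fun y hy ↦ chartDensity_eq_zero_of_notMem_left (symm_notMem_tsupport hy)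
  have h1 : ∀ i, ∫ y in (extChartAt (𝓡 7) i).target, chartDensity φ β a (fun _ ↦ 1) (f i) i y =
      ∑ j ∈ I, ∫ y in (extChartAt (𝓡 7) j).target, chartDensity φ β a (f j) (f i) j y := by
    intro i
    rw [← Finset.sum_congr rfl fun j _ ↦ integral_chartDensity_eq hφ (hf i) (hsupp i) (hsupp j),
      ← MeasureTheory.integral_finsetSum _ fun j _ ↦ int1 i j]
    refine MeasureTheory.setIntegral_congr_fun (isOpen_target7 i).measurableSet fun y _ ↦ ?_
    simp only [chartDensity]
    rw [← Finset.mul_sum, ← Finset.sum_mul, hsum]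
  rw [Finset.sum_congr rfl fun i _ ↦ h1 i, Finset.sum_comm]
  refine Finset.sum_eq_zero fun j _ ↦ ?_
  rw [← MeasureTheory.integral_finsetSum _ fun i _ ↦ int2 i j]
  refine MeasureTheory.setIntegral_eq_zero_of_forall_eq_zero fun y hy ↦ ?_
  have hd : ∑ i ∈ I, fderiv ℝ (fun z ↦ f i ((extChartAt (𝓡 7) j).symm z)) y = 0 := by
    rw [← fderiv_fun_sum fun i _ ↦ ((contDiffOn_comp_symm (hf i) j).contDiffAt
      ((isOpen_target7 j).mem_nhds hy)).differentiableAt (by simp)]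
    simp [hsum]
  simp only [chartDensity]
  rw [← Finset.mul_sum, ← Finset.mul_sum, ← altCoeff_tensor1222_sum, hd, altCoeff_tensor1222_zero]
  simp

theorem exists_finite_partition [T2Space M] : ∃ (I : Finset M) (f : M → M → ℝ),
    (∀ i, ContMDiff (𝓡 7) 𝓘(ℝ, ℝ) ∞ (f i)) ∧ (∀ i p, 0 ≤ f i p) ∧
    (∀ i, tsupport (f i) ⊆ (extChartAt (𝓡 7) i).source) ∧ ∀ p, ∑ i ∈ I, f i p = 1 := by
  obtain ⟨f, hf⟩ := SmoothPartitionOfUnity.exists_isSubordinate_chartAt_source (𝓡 7) M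
  have hfin := f.locallyFinite.finite_nonempty_of_compact
  refine ⟨hfin.toFinset, fun i ↦ f i, fun i ↦ (f i).contMDiff, fun i p ↦ f.nonneg i p,
    fun i ↦ ?_, fun p ↦ ?_⟩
  · rw [extChartAt_source]
    exact hf i
  · refine f.sum_finsupport' p (Set.mem_univ p) fun i hi ↦ ?_
    rw [Set.Finite.mem_toFinset]
    exact ⟨p, (f.mem_finsupport p).1 hi⟩

/-- On a compact manifold with an exact `G₂`-structure, a vector field whose contraction with the
`G₂`-form is closed vanishes. -/
theorem eq_zero_of_d_contract_eq_zero [T2Space M] (hφ : IsG2Structure φ) (hβ : β.IsSmooth)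
    (hφβ : φ = β.d) {X : (x : M) → TangentSpace (𝓡 7) x} (hX : IsSmoothVectorField X)
    (hd : (φ.contract X).d = 0) : X = 0 := by
  obtain ⟨I, f, hf, hf0, hsupp, hsum⟩ := exists_finite_partition (M := M)
  have ha : (φ.contract X).IsSmooth := hφ.1.contract hX
  have hst := fun i ↦ integral_chartDensity_add hφ hβ hφβ ha hd (hf i) (hsupp i)
  have hsum0 := sum_integral_chartDensity_eq_zero (a := φ.contract X) hφ hβ ha I f hf hsupp hsum
  have hb : ∀ i, ∀ y ∈ (extChartAt (𝓡 7) i).target,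
      altCoeff (tensor322 (φ.inChart i y) ((φ.contract X).inChart i y)
        ((φ.contract X).inChart i y)) = bryantForm (φ.inChart i y) (vectorFieldInChart X i y) := by
    intro i y hy
    rw [φ.contract_inChart X hy, bryantForm]
  have hnonneg : ∀ i, ∀ y ∈ (extChartAt (𝓡 7) i).target, 0 ≤ orientSign (φ.inChart i y) *
      (f i ((extChartAt (𝓡 7) i).symm y) * altCoeff (tensor322 (φ.inChart i y)
        ((φ.contract X).inChart i y) ((φ.contract X).inChart i y))) := by
    intro i y hy
    rw [hb i y hy, mul_left_comm]
    exact mul_nonneg (hf0 _ _)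
      ((hφ.isG2Form_inChart hy).orientSign_mul_bryantForm_nonneg _)
  have hint0 : ∀ i ∈ I, ∫ y in (extChartAt (𝓡 7) i).target, orientSign (φ.inChart i y) *
      (f i ((extChartAt (𝓡 7) i).symm y) * altCoeff (tensor322 (φ.inChart i y)
        ((φ.contract X).inChart i y) ((φ.contract X).inChart i y))) = 0 := by
    -- Stokes gives zero only for the sum over all charts; nonnegativity makes each integral vanish.
    rw [← Finset.sum_eq_zero_iff_of_nonneg fun i _ ↦
      MeasureTheory.setIntegral_nonneg (isOpen_target7 i).measurableSet (hnonneg i)]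
    have h := Finset.sum_eq_zero fun i (_ : i ∈ I) ↦ (hst i).2
    rw [Finset.sum_add_distrib, ← Finset.mul_sum, hsum0, mul_zero, zero_add] at h
    exact h
  funext p
  obtain ⟨i, hiI, hi⟩ : ∃ i ∈ I, f i p ≠ 0 := by
    by_contra! h
    exact one_ne_zero ((hsum p).symm.trans (Finset.sum_eq_zero h))
  have hp : p ∈ (extChartAt (𝓡 7) i).source := hsupp i (subset_tsupport _ hi)
  have hy := (extChartAt (𝓡 7) i).map_source hp
  -- A nonnegative integrand with zero integral vanishes almost everywhere, hence by continuity
  -- everywhere on the open chart target. At `p` the weight `f i p` is nonzero, so definiteness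
  -- forces the field to vanish there.
  have hae := (MeasureTheory.setIntegral_eq_zero_iff_of_nonneg_ae
    ((MeasureTheory.ae_restrict_iff' (isOpen_target7 i).measurableSet).2
      (Filter.Eventually.of_forall (hnonneg i))) (hst i).1).1 (hint0 i hiI)
  have hEq := MeasureTheory.Measure.eqOn_open_of_ae_eq hae (isOpen_target7 i)
    ((contDiffOn_orientSign hφ i).continuousOn.mul ((contDiffOn_comp_symm (hf i) i).continuousOn.mul
      (contDiffOn_altCoeff_tensor322 (hφ.1 i) (ha i) (ha i)).continuousOn)) continuousOn_const hy
  have hG2 := hφ.isG2Form_inChart hy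
  have hV : vectorFieldInChart X i (extChartAt (𝓡 7) i p) = 0 := by
    by_contra hV
    refine mul_ne_zero hG2.orientSign_ne_zero (mul_ne_zero ?_ (hG2.bryantForm_ne_zero hV))
      ((congrArg _ (congrArg _ (hb i _ hy))).symm.trans hEq)
    rwa [(extChartAt (𝓡 7) i).left_inv hp]
  have hXp := mfderiv_vectorFieldInChart X hy
  have key : ∀ q, q = p → X q = 0 → X p = 0 := by
    rintro q rfl h
    exact h
  refine key _ ((extChartAt (𝓡 7) i).left_inv hp) (hXp.symm.trans ?_)
  exact (congrArg _ hV).trans (ContinuousLinearMap.map_zero _)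

theorem lieDerivCoord_zero_field {n k : ℕ} (η : RSpace n → (RSpace n) [⋀^Fin k]→L[ℝ] ℝ)
    (y : RSpace n) : lieDerivCoord (0 : RSpace n → RSpace n) η y = 0 := by
  ext v
  rw [lieDerivCoord_apply]
  have h : ∑ i, η y (Function.update v i (fderiv ℝ (0 : RSpace n → RSpace n) y (v i))) = 0 :=
    Finset.sum_eq_zero fun i _ ↦ (η y).map_coord_zero i (by simp)
  rw [h, Pi.zero_apply, map_zero, add_zero]

theorem lieDeriv_zero_field {n k : ℕ} {N : Type*} [TopologicalSpace N]
    [ChartedSpace (RSpace n) N] (α : DiffForm n k N) : DiffForm.lieDeriv 0 α = 0 := by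
  funext x
  have h : lieDerivCoord (VectorField.mpullback 𝓘(ℝ, RSpace n) (𝓡 n) (extChartAt (𝓡 n) x).symm 0)
      (α.inChart x) (extChartAt (𝓡 n) x x) = 0 :=
    (congrArg (fun V ↦ lieDerivCoord V (α.inChart x) (extChartAt (𝓡 n) x x))
      VectorField.mpullback_zero).trans (lieDerivCoord_zero_field _ _)
  rw [DiffForm.lieDeriv, h]
  rfl

end Rigidity

theorem mainTheorem4 {M : Type*} [TopologicalSpace M] [T2Space M] [CompactSpace M]
    [ChartedSpace (RSpace 7) M] [IsManifold (𝓡 7) ∞ M]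
    (φ : DiffForm 7 3 M) (hφ : IsG2Structure φ)
    (β : DiffForm 7 2 M) (hβ : β.IsSmooth) (hφβ : φ = β.d)
    (X : (x : M) → TangentSpace (𝓡 7) x) (hX : IsSmoothVectorField X) :
    DiffForm.lieDeriv X φ = 0 ↔ X = 0 := by
  constructor
  · intro h
    refine eq_zero_of_d_contract_eq_zero hφ hβ hφβ hX ?_
    subst hφβ
    exact DiffForm.d_contract_eq_zero hX hβ hφ.1 h
  · rintro rfl
    exact lieDeriv_zero_field φ
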